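/- Let $n\ge 2$, let $\Xi$ be a real antisymmetric $(n+1)\times(n+1)$ matrix and let $P=\mathbb{T}^{n+1}_\Xi$ be the smooth quantum torus: the $\ast$-algebra of the series $\sum_{r\in\mathbb{Z}^{n+1}}a_r\,u_1^{r_1}\cdots u_{n+1}^{r_{n+1}}$ with rapidly decreasing coefficients $a_r\in\mathbb{C}$ in unitaries with $u_ku_j=e^{2\pi i\,\Xi_{kj}}u_ju_k$. Let $G=\mathbb{C}[z,z^{-1}]$ be the Hopf $\ast$-algebra of polynomial functions on $U(1)$, let $\Delta_P(u_j)=u_j\otimes 1$ for $j\le n$ and $\Delta_P(u_{n+1})=u_{n+1}\otimes z$, and let $B=\mathbb{T}^n_\Xi\subset P$ be the quantum torus generated by $u_1,\dots,u_n$ (the elements with $\Delta_P(b)=b\otimes 1$). (For the smooth algebra, $\otimes G$ is understood as a completed tensor product.) The differential forms are $\Omega^\bullet(P)=P\otimes\Lambda^\bullet\mathbb{C}^{n+1}$ with basis $dU_j$ of $\mathbb{C}^{n+1}$, differential determined by $d a=i\sum_j\delta_j(a)\,dU_j$, $\delta_j(u_k)=2\pi i\,\delta_{jk}u_k$, involution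 $(a\otimes v)^\ast=a^\ast\otimes v^\ast$, and coaction $\Delta_\Omega$ which extends $\Delta_P$ with $\Delta_\Omega(du_j)=du_j\otimes 1$ for $j\le n$, $\Delta_\Omega(du_{n+1})=du_{n+1}\otimes z+u_{n+1}\otimes dz$; here $U(1)$ has its classical calculus, and $\Omega^\bullet(B)=B\otimes\Lambda^\bullet\mathbb{C}^n$ carries the Hodge operator $\star_q=\mathrm{id}\otimes\star$. Put $\mathfrak{u}(1)^\#=\mathrm{Ker}\,\epsilon/(\mathrm{Ker}\,\epsilon)^2$, $\pi(g)=i[g-\epsilon(g)1]$ (identified with the left-invariant form $S(g^{(1)})dg^{(2)}$), $\pi(g)^\ast=\pi(S(g)^\ast)$, $\vartheta=\pi(z)$, and let $\mathrm{ad}$ be the corepresentation of $G$ on $\mathfrak{u}(1)^\#$ with $\mathrm{ad}\circ\pi=(\pi\otimes\mathrm{id})\circ\mathrm{Ad}$, $\mathrm{Ad}(g)=g^{(2)}\otimes S(g^{(1)})g^{(3)}$. A quantum principal connection (qpc) is a linear map $\omega:\mathfrak{u}(1)^\#\to\Omega^1(P)$ with $\Delta_\Omega(\omega(\theta))=(\omega\otimes\mathrm{id})\mathrm{ad}(\theta)+1\otimes\theta$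 and $\omega(\theta^\ast)=\omega(\theta)^\ast$; its covariant derivatives are $D^\omega\varphi=d\varphi-(-1)^k\varphi^{(0)}\,\omega(\pi(\varphi^{(1)}))$ on horizontal $k$-forms, and $\widehat D^\omega=-\ast\circ D^\omega\circ\ast$. Let $E$ be the right $B$-module of linear maps $T:\mathfrak{u}(1)^\#\to P$ which intertwine $\mathrm{ad}$ and $\Delta_P$, where $(Tb)(\theta)=T(\theta)b$, with the metric $\langle T_1,T_2\rangle=T_1(\vartheta)^\ast T_2(\vartheta)$. A quantum linear connection (qlc) on $E$ is a linear map $\nabla:E\to E\otimes_B\Omega^1(B)$ with $\nabla(Tb)=\nabla(T)b+T\otimes_B db$; it is compatible with the metric if $\langle T_1,\nabla T_2\rangle-\langle\nabla T_1,T_2\rangle=d\langle T_1,T_2\rangle$. Its exterior covariant derivative is $d^\nabla(T\otimes_B\mu)=\nabla(T)\mu+T\otimes_B d\mu$, its curvature is $R^\nabla=d^\nabla\circ\nabla$, and for a right $B$-linear map $\Lambda:E\to E\otimes_B\Omega^k(B)$ one puts $[\nabla,\Lambda]=d^\nabla\circ\Lambda-(-1)^k\widetilde\Lambda\circ\nabla$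 with $\widetilde\Lambda(T\otimes_B\mu)=\Lambda(T)\mu$. The gauge connection induced by a qpc $\omega$ is the map $\nabla^\omega:E\to E\otimes_B\Omega^1(B)$ determined by $\Upsilon(\nabla^\omega T)=\widehat D^\omega\circ T$, where $\Upsilon(T\otimes_B\mu)(\theta)=T(\theta)\mu$. Then for every qpc $\omega$: the gauge connection $\nabla^\omega$ exists and is unique, and it is a qlc compatible with the metric. It is the Grassmann connection: every $T\in E$ has the form $T=T^{\mathrm{triv}}b$, where $T^{\mathrm{triv}}(w\vartheta)=w1$ for $w\in\mathbb{C}$ and $b=T(\vartheta)\in B$, and $\nabla^\omega(T)=T^{\mathrm{triv}}\otimes_B db$. It has zero curvature, $R^{\nabla^\omega}=0$, and it therefore solves the analytical Yang–Mills equation $[\nabla^\omega,(\mathrm{id}_E\otimes_B\star_q)\circ R^{\nabla^\omega}]=0$. -/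

import Mathlib

open scoped TensorProduct

noncomputable section

namespace QuantumTorus

variable {m n : ℕ} {Ξ : Matrix (Fin m) (Fin m) ℝ}

/-! ### The smooth algebra of the quantum torus -/

/-- A function on `ℤ^m` is rapidly decreasing if it decays faster than the inverse of any
polynomial. -/
def IsRapid {m : ℕ} (a : (Fin m → ℤ) → ℂ) : Prop :=
  ∀ k : ℕ, ∃ C : ℝ, ∀ r, (1 + ‖r‖) ^ k * ‖a r‖ ≤ C

/-- The space of rapidly decreasing functions on `ℤ^m`. -/
def rapid (m : ℕ) : Submodule ℂ ((Fin m → ℤ) → ℂ) where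
  carrier := {a | IsRapid a}
  zero_mem' := fun k => ⟨0, fun r => by simp⟩
  add_mem' := by
    intro a b ha hb k
    obtain ⟨C, hC⟩ := ha k
    obtain ⟨D, hD⟩ := hb k
    refine ⟨C + D, fun r => ?_⟩
    have h1 : ‖(a + b) r‖ ≤ ‖a r‖ + ‖b r‖ := norm_add_le _ _
    have h2 : (0 : ℝ) ≤ (1 + ‖r‖) ^ k := by positivity
    nlinarith [hC r, hD r, mul_le_mul_of_nonneg_left h1 h2]
  smul_mem' := by
    intro c a ha k
    obtain ⟨C, hC⟩ := ha k
    refine ⟨‖c‖ * C, fun r => ?_⟩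
    have h : (1 + ‖r‖) ^ k * ‖(c • a) r‖ = ‖c‖ * ((1 + ‖r‖) ^ k * ‖a r‖) := by
      simp only [Pi.smul_apply, smul_eq_mul, norm_mul]; ring
    rw [h]
    exact mul_le_mul_of_nonneg_left (hC r) (norm_nonneg c)

lemma summable_prod_inv (m : ℕ) :
    Summable fun r : Fin m → ℤ => ∏ i, ((1 + ‖r i‖) ^ 2)⁻¹ := by
  induction m with
  | zero => exact Summable.of_finite
  | succ m ih =>
    have h1 : Summable fun z : ℤ => ((1 + ‖z‖) ^ 2)⁻¹ := by
      have h0 : Summable fun z : ℤ => 1 / (z : ℝ) ^ 2 :=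
        Real.summable_one_div_int_pow.mpr (by norm_num)
      refine Summable.of_norm_bounded_eventually (h0) ?_
      refine (Set.finite_singleton (0 : ℤ)).subset ?_
      intro z hz
      by_contra hz0
      apply hz
      have hz1 : (0 : ℝ) < |(z : ℝ)| := by simpa using hz0
      show ‖((1 + ‖z‖) ^ 2)⁻¹‖ ≤ 1 / (z : ℝ) ^ 2
      rw [Real.norm_of_nonneg (by positivity), one_div, ← sq_abs (z : ℝ), Int.norm_eq_abs]
      gcongr
      linarith
    have h2 := h1.mul_of_nonneg ih (fun z => by positivity)
      (fun r => Finset.prod_nonneg fun i _ => by positivity)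
    rw [← (Fin.consEquiv fun _ => ℤ).summable_iff]
    refine h2.congr fun x => ?_
    simp [Fin.prod_univ_succ, Fin.consEquiv, mul_comm]

lemma IsRapid.summable {m : ℕ} {a : (Fin m → ℤ) → ℂ} (ha : IsRapid a) (k : ℕ) :
    Summable fun r => (1 + ‖r‖) ^ k * ‖a r‖ := by
  obtain ⟨C, hC⟩ := ha (k + 2 * m)
  refine Summable.of_nonneg_of_le (fun r => by positivity) (fun r => ?_)
    ((summable_prod_inv m).mul_left C)
  have hp : ∏ i, (1 + ‖r i‖) ^ 2 ≤ (1 + ‖r‖) ^ (2 * m) := by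
    calc ∏ i, (1 + ‖r i‖) ^ 2 ≤ ∏ _i : Fin m, (1 + ‖r‖) ^ 2 := by
          refine Finset.prod_le_prod (fun i _ => by positivity) fun i _ => ?_
          gcongr
          exact norm_le_pi_norm r i
      _ = _ := by simp [pow_mul]
  have hpos : 0 < ∏ i, (1 + ‖r i‖) ^ 2 := Finset.prod_pos fun i _ => by positivity
  rw [Finset.prod_inv_distrib, ← div_eq_mul_inv, le_div_iff₀ hpos]
  calc (1 + ‖r‖) ^ k * ‖a r‖ * ∏ i, (1 + ‖r i‖) ^ 2
      ≤ (1 + ‖r‖) ^ k * ‖a r‖ * (1 + ‖r‖) ^ (2 * m) := by gcongr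
    _ = (1 + ‖r‖) ^ (k + 2 * m) * ‖a r‖ := by ring
    _ ≤ C := hC r

/-- The exponent `∑_{j < k} r_k Ξ_{kj} s_j`, which is picked up when `u_1^{r_1} ⋯ u_m^{r_m}` and
`u_1^{s_1} ⋯ u_m^{s_m}` are multiplied. -/
def phase {m : ℕ} (Ξ : Matrix (Fin m) (Fin m) ℝ) (r s : Fin m → ℤ) : ℝ :=
  ∑ k, ∑ j, if j < k then (r k : ℝ) * Ξ k j * (s j : ℝ) else 0

/-- `u^r u^s = twist Ξ r s • u^{r+s}` for the ordered monomials `u^r = u_1^{r_1} ⋯ u_m^{r_m}` in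
unitaries with `u_k u_j = exp(2 π i Ξ_{kj}) u_j u_k`. -/
def twist {m : ℕ} (Ξ : Matrix (Fin m) (Fin m) ℝ) (r s : Fin m → ℤ) : ℂ :=
  Complex.exp ((2 * Real.pi * phase Ξ r s : ℝ) * Complex.I)

lemma phase_add_left (r r' s : Fin m → ℤ) :
    phase Ξ (r + r') s = phase Ξ r s + phase Ξ r' s := by
  simp only [phase, ← Finset.sum_add_distrib]
  refine Finset.sum_congr rfl fun k _ => Finset.sum_congr rfl fun j _ => ?_
  split_ifs <;> simp; ring

lemma phase_add_right (r s s' : Fin m → ℤ) :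
    phase Ξ r (s + s') = phase Ξ r s + phase Ξ r s' := by
  simp only [phase, ← Finset.sum_add_distrib]
  refine Finset.sum_congr rfl fun k _ => Finset.sum_congr rfl fun j _ => ?_
  split_ifs <;> simp; ring

lemma norm_twist (r s : Fin m → ℤ) : ‖twist Ξ r s‖ = 1 := Complex.norm_exp_ofReal_mul_I _

lemma twist_add_left (r r' s : Fin m → ℤ) :
    twist Ξ (r + r') s = twist Ξ r s * twist Ξ r' s := by
  rw [twist, twist, twist, ← Complex.exp_add, phase_add_left]
  congr 1; push_cast; ring

lemma twist_add_right (r s s' : Fin m → ℤ) :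
    twist Ξ r (s + s') = twist Ξ r s * twist Ξ r s' := by
  rw [twist, twist, twist, ← Complex.exp_add, phase_add_right]
  congr 1; push_cast; ring

@[simp] lemma twist_zero_left (s : Fin m → ℤ) : twist Ξ 0 s = 1 := by simp [twist, phase]

@[simp] lemma twist_zero_right (s : Fin m → ℤ) : twist Ξ s 0 = 1 := by simp [twist, phase]

/-- The twisted convolution product. -/
def conv (Ξ : Matrix (Fin m) (Fin m) ℝ) (a b : (Fin m → ℤ) → ℂ) : (Fin m → ℤ) → ℂ :=
  fun t => ∑' r, a r * b (t - r) * twist Ξ r (t - r)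

lemma IsRapid.summable_norm {a : (Fin m → ℤ) → ℂ} (ha : IsRapid a) :
    Summable fun r => ‖a r‖ := by simpa using ha.summable 0

lemma IsRapid.bdd {a : (Fin m → ℤ) → ℂ} (ha : IsRapid a) : ∃ C, ∀ r, ‖a r‖ ≤ C := by
  simpa using ha 0

lemma conv_summable {a b : (Fin m → ℤ) → ℂ} (ha : IsRapid a) (hb : IsRapid b) (t : Fin m → ℤ) :
    Summable fun r => ‖a r * b (t - r) * twist Ξ r (t - r)‖ := by
  obtain ⟨C, hC⟩ := hb.bdd
  refine Summable.of_nonneg_of_le (fun _ => norm_nonneg _) (fun r => ?_)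
    (ha.summable_norm.mul_right C)
  rw [norm_mul, norm_mul, norm_twist, mul_one]
  gcongr
  exact hC _

lemma one_add_norm_le (r t : Fin m → ℤ) : 1 + ‖t‖ ≤ (1 + ‖r‖) * (1 + ‖t - r‖) := by
  have h : ‖t‖ ≤ ‖r‖ + ‖t - r‖ := by simpa using norm_add_le r (t - r)
  nlinarith [norm_nonneg r, norm_nonneg (t - r), mul_nonneg (norm_nonneg r) (norm_nonneg (t - r))]

lemma IsRapid.conv {a b : (Fin m → ℤ) → ℂ} (ha : IsRapid a) (hb : IsRapid b) :
    IsRapid (conv Ξ a b) := by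
  intro k
  obtain ⟨C, hC⟩ := hb k
  have hC0 : 0 ≤ C := le_trans (by positivity) (hC 0)
  refine ⟨(∑' r, (1 + ‖r‖) ^ k * ‖a r‖) * C, fun t => ?_⟩
  have h1 : ‖QuantumTorus.conv Ξ a b t‖ ≤ ∑' r, ‖a r * b (t - r) * twist Ξ r (t - r)‖ :=
    norm_tsum_le_tsum_norm (conv_summable ha hb t)
  calc (1 + ‖t‖) ^ k * ‖QuantumTorus.conv Ξ a b t‖
      ≤ (1 + ‖t‖) ^ k * ∑' r, ‖a r * b (t - r) * twist Ξ r (t - r)‖ := by gcongr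
    _ = ∑' r, (1 + ‖t‖) ^ k * ‖a r * b (t - r) * twist Ξ r (t - r)‖ := tsum_mul_left.symm
    _ ≤ ∑' r, (1 + ‖r‖) ^ k * ‖a r‖ * C := by
        refine Summable.tsum_le_tsum (fun r => ?_) ((conv_summable ha hb t).mul_left _)
          ((ha.summable k).mul_right C)
        rw [norm_mul, norm_mul, norm_twist, mul_one]
        calc (1 + ‖t‖) ^ k * (‖a r‖ * ‖b (t - r)‖)
            ≤ ((1 + ‖r‖) * (1 + ‖t - r‖)) ^ k * (‖a r‖ * ‖b (t - r)‖) := by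
              gcongr
              exact one_add_norm_le r t
          _ = (1 + ‖r‖) ^ k * ‖a r‖ * ((1 + ‖t - r‖) ^ k * ‖b (t - r)‖) := by
              rw [mul_pow]; ring
          _ ≤ _ := by gcongr; exact hC _
    _ = _ := tsum_mul_right

lemma tsum_shift {A : Type*} [AddCommGroup A] (F : A → A → ℂ)
    (hs : Summable fun p : A × A => F p.1 p.2) :
    ∑' q, ∑' r, F r (q - r) = ∑' r, ∑' s, F r s := by
  have hinj : Function.Injective (fun p : A × A => (p.1, p.2 - p.1)) := by
    rintro ⟨x, y⟩ ⟨x', y'⟩ h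
    obtain ⟨h1, h2⟩ := Prod.mk.inj h
    subst h1
    exact Prod.ext rfl (sub_left_injective h2)
  have hs' : Summable fun p : A × A => F p.1 (p.2 - p.1) := hs.comp_injective hinj
  have e3 : ∑' q, ∑' r, F r (q - r) = ∑' r, ∑' q, F r (q - r) :=
    Summable.tsum_comm (f := fun r q => F r (q - r)) hs'
  rw [e3]
  refine tsum_congr fun r => ?_
  exact (Equiv.subRight r).tsum_eq (fun s => F r s)

lemma conv_assoc {a b c : (Fin m → ℤ) → ℂ} (ha : IsRapid a) (hb : IsRapid b) (hc : IsRapid c) :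
    conv Ξ (conv Ξ a b) c = conv Ξ a (conv Ξ b c) := by
  funext t
  obtain ⟨C, hC⟩ := hc.bdd
  set F : (Fin m → ℤ) → (Fin m → ℤ) → ℂ := fun r s =>
    a r * b s * c (t - r - s) * (twist Ξ r s * twist Ξ r (t - r - s) * twist Ξ s (t - r - s))
    with hF
  have hs : Summable fun p : (Fin m → ℤ) × (Fin m → ℤ) => F p.1 p.2 := by
    refine Summable.of_norm_bounded (g := fun p => ‖a p.1‖ * ‖b p.2‖ * C)
      ((ha.summable_norm.mul_of_nonneg hb.summable_norm (fun _ => norm_nonneg _)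
        (fun _ => norm_nonneg _)).mul_right C) fun p => ?_
    simp only [hF, norm_mul, norm_twist, mul_one]
    gcongr
    exact hC _
  have e1 : conv Ξ a (conv Ξ b c) t = ∑' r, ∑' s, F r s := by
    refine tsum_congr fun r => ?_
    simp only [conv]
    rw [← tsum_mul_left, ← tsum_mul_right]
    refine tsum_congr fun s => ?_
    have h : twist Ξ r (t - r) = twist Ξ r s * twist Ξ r (t - r - s) := by
      rw [← twist_add_right]; congr 1; abel
    rw [h]; simp only [hF]; ring
  have e2 : conv Ξ (conv Ξ a b) c t = ∑' q, ∑' r, F r (q - r) := by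
    refine tsum_congr fun q => ?_
    simp only [conv]
    rw [← tsum_mul_right, ← tsum_mul_right]
    refine tsum_congr fun r => ?_
    have h : twist Ξ q (t - q) = twist Ξ r (t - q) * twist Ξ (q - r) (t - q) := by
      rw [← twist_add_left]; congr 1; abel
    have h' : t - r - (q - r) = t - q := by abel
    rw [h]; simp only [hF, h']; ring
  rw [e1, e2]
  exact tsum_shift F hs

/-- The smooth algebra of the quantum torus with parameter matrix `Ξ`: the formal sums
`∑ a_r u_1^{r_1} ⋯ u_m^{r_m}` with rapidly decreasing coefficients. -/
def QTorus {m : ℕ} (_Ξ : Matrix (Fin m) (Fin m) ℝ) : Type := ↥(rapid m)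

instance : AddCommGroup (QTorus Ξ) := inferInstanceAs (AddCommGroup (rapid m))

instance : Module ℂ (QTorus Ξ) := inferInstanceAs (Module ℂ (rapid m))

/-- The coefficient `a_r` of `∑ a_r u_1^{r_1} ⋯ u_m^{r_m}`. -/
def coeff (a : QTorus Ξ) : (Fin m → ℤ) → ℂ := a.1

/-- The element of the quantum torus with given coefficients. -/
def ofRapid (Ξ : Matrix (Fin m) (Fin m) ℝ) (a : (Fin m → ℤ) → ℂ) (ha : IsRapid a) : QTorus Ξ :=
  ⟨a, ha⟩

@[ext] lemma QTorus.ext {a b : QTorus Ξ} (h : ∀ r, coeff a r = coeff b r) : a = b :=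
  Subtype.ext (funext h)

lemma coeff_rapid (a : QTorus Ξ) : IsRapid (coeff a) := a.2

@[simp] lemma coeff_ofRapid (a : (Fin m → ℤ) → ℂ) (ha : IsRapid a) :
    coeff (ofRapid Ξ a ha) = a := rfl

@[simp] lemma coeff_add (a b : QTorus Ξ) : coeff (a + b) = coeff a + coeff b := rfl

@[simp] lemma coeff_sub (a b : QTorus Ξ) : coeff (a - b) = coeff a - coeff b := rfl

@[simp] lemma coeff_neg (a : QTorus Ξ) : coeff (-a) = -coeff a := rfl

@[simp] lemma coeff_zero : coeff (0 : QTorus Ξ) = 0 := rfl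

@[simp] lemma coeff_smul (c : ℂ) (a : QTorus Ξ) : coeff (c • a) = c • coeff a := rfl

lemma isRapid_single (s : Fin m → ℤ) : IsRapid (Pi.single s (1 : ℂ)) := by
  intro k
  refine ⟨(1 + ‖s‖) ^ k, fun r => ?_⟩
  rcases eq_or_ne r s with rfl | h
  · simp
  · simp only [Pi.single_eq_of_ne h, norm_zero, mul_zero]; positivity

/-- The ordered monomial `u^r = u_1^{r_1} ⋯ u_m^{r_m}`. -/
def mono (Ξ : Matrix (Fin m) (Fin m) ℝ) (r : Fin m → ℤ) : QTorus Ξ :=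
  ofRapid Ξ (Pi.single r 1) (isRapid_single r)

instance : Mul (QTorus Ξ) :=
  ⟨fun a b => ofRapid Ξ (conv Ξ (coeff a) (coeff b)) ((coeff_rapid a).conv (coeff_rapid b))⟩

instance : One (QTorus Ξ) := ⟨mono Ξ 0⟩

lemma coeff_mul (a b : QTorus Ξ) (t : Fin m → ℤ) :
    coeff (a * b) t = ∑' r, coeff a r * coeff b (t - r) * twist Ξ r (t - r) := rfl

lemma coeff_one : coeff (1 : QTorus Ξ) = Pi.single 0 1 := rfl

lemma mul_summable (a b : QTorus Ξ) (t : Fin m → ℤ) :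
    Summable fun r => coeff a r * coeff b (t - r) * twist Ξ r (t - r) :=
  (conv_summable (coeff_rapid a) (coeff_rapid b) t).of_norm

instance : Ring (QTorus Ξ) :=
  { (inferInstance : AddCommGroup (QTorus Ξ)) with
    mul := (· * ·)
    one := 1
    left_distrib := fun a b c => by
      ext t
      simp only [coeff_add, Pi.add_apply, coeff_mul, mul_add, add_mul]
      exact (mul_summable a b t).tsum_add (mul_summable a c t)
    right_distrib := fun a b c => by
      ext t
      simp only [coeff_add, Pi.add_apply, coeff_mul, add_mul]
      exact (mul_summable a c t).tsum_add (mul_summable b c t)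
    zero_mul := fun a => by ext t; simp [coeff_mul]
    mul_zero := fun a => by ext t; simp [coeff_mul]
    mul_assoc := fun a b c => by
      ext t
      exact congrFun (conv_assoc (coeff_rapid a) (coeff_rapid b) (coeff_rapid c)) t
    one_mul := fun a => by
      ext t
      rw [coeff_mul, tsum_eq_single 0]
      · simp [coeff_one]
      · intro r hr; simp [coeff_one, Pi.single_eq_of_ne hr]
    mul_one := fun a => by
      ext t
      rw [coeff_mul, tsum_eq_single t]
      · simp [coeff_one]
      · intro r hr
        have : t - r ≠ 0 := fun h => hr (sub_eq_zero.mp h).symm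
        simp [coeff_one, Pi.single_eq_of_ne this] }

instance : Algebra ℂ (QTorus Ξ) :=
  Algebra.ofModule
    (fun c a b => by
      ext t
      simp only [coeff_smul, Pi.smul_apply, coeff_mul, smul_eq_mul, ← tsum_mul_left]
      exact tsum_congr fun r => by ring)
    (fun c a b => by
      ext t
      simp only [coeff_smul, Pi.smul_apply, coeff_mul, smul_eq_mul, ← tsum_mul_left]
      exact tsum_congr fun r => by ring)

/-- The involution, determined by `(u^r)^* = (u^r)^{-1}`. -/
instance : Star (QTorus Ξ) :=
  ⟨fun a => ofRapid Ξ (fun r => (starRingEnd ℂ) (coeff a (-r)) * twist Ξ r r) fun k => by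
    obtain ⟨C, hC⟩ := coeff_rapid a k
    refine ⟨C, fun r => ?_⟩
    simpa [norm_twist] using hC (-r)⟩

lemma coeff_star (a : QTorus Ξ) (r : Fin m → ℤ) :
    coeff (star a) r = (starRingEnd ℂ) (coeff a (-r)) * twist Ξ r r := rfl

/-- The topology of coefficientwise convergence, used for sums over the characters of `U(1)`. -/
instance : TopologicalSpace (QTorus Ξ) := TopologicalSpace.induced coeff inferInstance

/-- The derivation `δ_j`, with `δ_j(u_k) = 2 π i δ_{jk} u_k`. -/
def delta (j : Fin m) : QTorus Ξ →ₗ[ℂ] QTorus Ξ where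
  toFun a := ofRapid Ξ (fun r => (2 * Real.pi * Complex.I * (r j : ℂ)) * coeff a r) fun k => by
    obtain ⟨C, hC⟩ := coeff_rapid a (k + 1)
    refine ⟨2 * Real.pi * C, fun r => ?_⟩
    have h1 : ‖(r j : ℂ)‖ ≤ 1 + ‖r‖ := by
      have h2 : ‖r j‖ ≤ ‖r‖ := norm_le_pi_norm r j
      rw [Complex.norm_intCast, ← Int.norm_eq_abs]
      linarith
    have h3 : ‖(2 * Real.pi * Complex.I * (r j : ℂ)) * coeff a r‖
        = 2 * Real.pi * (‖(r j : ℂ)‖ * ‖coeff a r‖) := by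
      simp [abs_of_pos Real.pi_pos, mul_assoc]
    rw [h3]
    calc (1 + ‖r‖) ^ k * (2 * Real.pi * (‖(r j : ℂ)‖ * ‖coeff a r‖))
        ≤ (1 + ‖r‖) ^ k * (2 * Real.pi * ((1 + ‖r‖) * ‖coeff a r‖)) := by
          have := Real.pi_pos
          gcongr
      _ = 2 * Real.pi * ((1 + ‖r‖) ^ (k + 1) * ‖coeff a r‖) := by ring
      _ ≤ _ := by
          have := Real.pi_pos
          gcongr
          exact hC r
  map_add' a b := by ext r; exact mul_add _ _ _
  map_smul' c a := by ext r; exact mul_left_comm _ _ _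

lemma coeff_delta (j : Fin m) (a : QTorus Ξ) (r : Fin m → ℤ) :
    coeff (delta j a) r = (2 * Real.pi * Complex.I * (r j : ℂ)) * coeff a r := rfl

lemma delta_mul (j : Fin m) (a b : QTorus Ξ) :
    delta j (a * b) = delta j a * b + a * delta j b := by
  ext t
  rw [coeff_add, Pi.add_apply, coeff_mul, coeff_mul, ← (mul_summable _ _ _).tsum_add
    (mul_summable _ _ _), coeff_delta, coeff_mul, ← tsum_mul_left]
  refine tsum_congr fun r => ?_
  simp only [coeff_delta, Pi.sub_apply]
  push_cast
  ring

/-! ### Differential forms -/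

/-- Differential forms on the quantum torus: `μ I` is the coefficient of
`dU_{i_1} ⋯ dU_{i_k}`, where `I = {i_1 < ⋯ < i_k}`; that is, the tensor product of the algebra with
the exterior algebra of `ℂ^m`. The product of forms is `wedge` below. The involution is
`(a ⊗ v)^* = a^* ⊗ v^*`, that is `star` of the coefficients: it is graded-antimultiplicative, and
every `dU_{i_1} ⋯ dU_{i_k}` with `i_1 < ⋯ < i_k` is fixed by it. -/
abbrev Forms {m : ℕ} (Ξ : Matrix (Fin m) (Fin m) ℝ) : Type := Finset (Fin m) → QTorus Ξ

/-- The sign which sorts the concatenation of the increasing lists `I` and `J`. -/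
def sgn (I J : Finset (Fin m)) : ℂ := (-1) ^ ((I ×ˢ J).filter fun p => p.2 < p.1).card

/-- The wedge product of forms; `dU_I dU_J = sgn I J • dU_{I ∪ J}` if `I` and `J` are disjoint,
`dU_I dU_J = 0` otherwise, and the `dU_I` commute with the algebra. -/
def wedge : Forms Ξ →ₗ[ℂ] Forms Ξ →ₗ[ℂ] Forms Ξ :=
  LinearMap.mk₂ ℂ (fun μ ν => fun K => ∑ I ∈ K.powerset, sgn I (K \ I) • (μ I * ν (K \ I)))
    (fun μ μ' ν => by ext1 K; simp [add_mul, smul_add, Finset.sum_add_distrib])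
    (fun c μ ν => by
      ext1 K
      simp only [Pi.smul_apply, Finset.smul_sum, smul_mul_assoc]
      exact Finset.sum_congr rfl fun I _ => smul_comm _ _ _)
    (fun μ ν ν' => by ext1 K; simp [mul_add, smul_add, Finset.sum_add_distrib])
    (fun c μ ν => by
      ext1 K
      simp only [Pi.smul_apply, Finset.smul_sum, mul_smul_comm]
      exact Finset.sum_congr rfl fun I _ => smul_comm _ _ _)

lemma wedge_apply (μ ν : Forms Ξ) (K : Finset (Fin m)) :
    wedge μ ν K = ∑ I ∈ K.powerset, sgn I (K \ I) • (μ I * ν (K \ I)) := rfl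

/-- The differential, `d a = i ∑ δ_j(a) dU_j` on the algebra. -/
def d : Forms Ξ →ₗ[ℂ] Forms Ξ where
  toFun μ := fun K => ∑ j ∈ K, (sgn {j} (K.erase j) * Complex.I) • delta j (μ (K.erase j))
  map_add' μ ν := by ext1 K; simp [smul_add, Finset.sum_add_distrib]
  map_smul' c μ := by
    ext1 K
    simp only [Pi.smul_apply, map_smul, Finset.smul_sum, RingHom.id_apply]
    exact Finset.sum_congr rfl fun I _ => smul_comm _ _ _

lemma d_apply (μ : Forms Ξ) (K : Finset (Fin m)) :
    d μ K = ∑ j ∈ K, (sgn {j} (K.erase j) * Complex.I) • delta j (μ (K.erase j)) := rfl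

/-- An element of the algebra as a form of degree `0`. -/
def of : QTorus Ξ →ₗ[ℂ] Forms Ξ where
  toFun a := fun I => if I = ∅ then a else 0
  map_add' a b := by ext1 I; by_cases h : I = ∅ <;> simp [h]
  map_smul' c a := by ext1 I; by_cases h : I = ∅ <;> simp [h]

lemma of_apply (a : QTorus Ξ) (I : Finset (Fin m)) : of a I = if I = ∅ then a else 0 := rfl

/-- The forms of degree `k`. -/
def degreePart (Ξ : Matrix (Fin m) (Fin m) ℝ) (k : ℕ) : Submodule ℂ (Forms Ξ) where
  carrier := {μ | ∀ I, I.card ≠ k → μ I = 0}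
  zero_mem' := fun _ _ => rfl
  add_mem' := fun ha hb I hI => by simp [ha I hI, hb I hI]
  smul_mem' := fun c μ h I hI => by simp [h I hI]

/-- The map which is multiplication by `(-1)^k` in degree `k`. -/
def gradeInv : Forms Ξ →ₗ[ℂ] Forms Ξ where
  toFun μ := fun I => ((-1 : ℂ) ^ I.card) • μ I
  map_add' μ ν := by ext1 I; simp
  map_smul' c μ := by ext1 I; exact smul_comm _ c _

/-- The Hodge operator: `⋆ (a dU_I) = sgn I Iᶜ • a dU_{Iᶜ}`, so that `dU_I (⋆ dU_I)` is the volume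
form. -/
def hodge : Forms Ξ →ₗ[ℂ] Forms Ξ where
  toFun μ := fun J => sgn Jᶜ J • μ Jᶜ
  map_add' μ ν := by ext1 I; simp
  map_smul' c μ := by ext1 I; exact smul_comm _ c _

lemma wedge_balanced (ν μ : Forms Ξ) (b : QTorus Ξ) :
    wedge (wedge ν (of b)) μ = wedge ν (b • μ) := by
  have h : wedge ν (of b) = fun K => ν K * b := by
    ext1 K
    rw [wedge_apply, Finset.sum_eq_single K]
    · simp [of_apply, sgn]
    · intro I hI hIK
      have : K \ I ≠ ∅ := fun h => hIK
        ((Finset.mem_powerset.mp hI).antisymm (Finset.sdiff_eq_empty_iff_subset.mp h))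
      simp [of_apply, this]
    · simp
  ext1 K
  rw [h, wedge_apply, wedge_apply]
  refine Finset.sum_congr rfl fun I _ => ?_
  simp [mul_assoc]

lemma wedge_of_left (b : QTorus Ξ) (μ : Forms Ξ) : wedge (of b) μ = b • μ := by
  ext1 K
  rw [wedge_apply, Finset.sum_eq_single ∅]
  · simp [of_apply, sgn]
  · intro I _ hI; simp [of_apply, hI]
  · simp

lemma d_smul (b : QTorus Ξ) (μ : Forms Ξ) : d (b • μ) = wedge (d (of b)) μ + b • d μ := by
  ext1 K
  have h : wedge (d (of b)) μ K
      = ∑ j ∈ K, (sgn {j} (K.erase j) * Complex.I) • (delta j b * μ (K.erase j)) := by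
    have hd : ∀ I : Finset (Fin m), d (of b) I = ∑ j, if I = {j} then Complex.I • delta j b else 0 := by
      intro I
      rw [d_apply, ← Finset.sum_filter_add_sum_filter_not Finset.univ (fun j => j ∈ I)]
      have h2 : ∑ j ∈ Finset.univ.filter (fun j => ¬ j ∈ I),
          (if I = {j} then Complex.I • delta j b else 0) = 0 := by
        refine Finset.sum_eq_zero fun j hj => if_neg ?_
        rintro rfl
        simp at hj
      rw [h2, add_zero]
      refine Finset.sum_congr (by ext; simp) fun j hj => ?_
      by_cases hI : I = {j}
      · subst hI; simp [of_apply, sgn]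
      · have : I.erase j ≠ ∅ := by
          intro h0
          rcases Finset.erase_eq_empty_iff _ _ |>.mp h0 with h0 | h0
          · subst h0; simp at hj
          · exact hI h0
        simp [of_apply, hI, this]
    rw [wedge_apply]
    simp only [hd, Finset.sum_mul, Finset.smul_sum]
    rw [Finset.sum_comm]
    rw [← Finset.sum_filter_add_sum_filter_not Finset.univ (fun j => j ∈ K)]
    have h2 : ∑ j ∈ Finset.univ.filter (fun j => ¬ j ∈ K), ∑ I ∈ K.powerset,
        sgn I (K \ I) • ((if I = {j} then Complex.I • delta j b else 0) * μ (K \ I)) = 0 := by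
      refine Finset.sum_eq_zero fun j hj => Finset.sum_eq_zero fun I hI => ?_
      rw [if_neg, zero_mul, smul_zero]
      rintro rfl
      simp at hI hj
      exact hj hI
    rw [h2, add_zero]
    refine Finset.sum_congr (by ext; simp) fun j hj => ?_
    rw [Finset.sum_eq_single {j}]
    · rw [if_pos rfl, smul_mul_assoc, smul_smul, Finset.sdiff_singleton_eq_erase]
    · intro I _ hI; simp [hI]
    · intro hI
      simp at hI hj
      exact absurd hj hI
  rw [Pi.add_apply, h, Pi.smul_apply, smul_eq_mul, d_apply, d_apply, Finset.mul_sum,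
    ← Finset.sum_add_distrib]
  refine Finset.sum_congr rfl fun j _ => ?_
  rw [Pi.smul_apply, smul_eq_mul, delta_mul, smul_add, mul_smul_comm]

/-! ### Completed tensor products with the functions on `U(1)` -/

/-- Adjoining a last entry. -/
def snoc (s : Fin m → ℤ) (z : ℤ) : Fin (m + 1) → ℤ := Fin.snoc (α := fun _ => ℤ) s z

/-- Forgetting the last entry. -/
def init (t : Fin (m + 1) → ℤ) : Fin m → ℤ := fun i => t i.castSucc

@[simp] lemma init_snoc (s : Fin m → ℤ) (z : ℤ) : init (snoc s z) = s := by
  funext i; simp [init, snoc]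

@[simp] lemma snoc_last (s : Fin m → ℤ) (z : ℤ) : snoc s z (Fin.last m) = z := by simp [snoc]

@[simp] lemma snoc_castSucc (s : Fin m → ℤ) (z : ℤ) (i : Fin m) : snoc s z i.castSucc = s i := by
  simp [snoc]

@[simp] lemma snoc_init (t : Fin (m + 1) → ℤ) : snoc (init t) (t (Fin.last m)) = t := by
  funext i
  refine Fin.lastCases ?_ (fun j => ?_) i
  · simp
  · simp [init]

lemma norm_le_max (t : Fin (m + 1) → ℤ) : ‖t‖ ≤ max ‖init t‖ ‖t (Fin.last m)‖ := by
  refine (pi_norm_le_iff_of_nonneg (le_trans (norm_nonneg _) (le_max_left _ _))).mpr fun i => ?_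
  refine Fin.lastCases ?_ (fun j => ?_) i
  · exact le_max_right _ _
  · exact le_trans (norm_le_pi_norm (init t) j) (le_max_left _ _)

lemma norm_init_le (t : Fin (m + 1) → ℤ) : ‖init t‖ ≤ ‖t‖ :=
  (pi_norm_le_iff_of_nonneg (norm_nonneg _)).mpr fun i => norm_le_pi_norm t i.castSucc

/-- The matrix `Ξ ⊕ 0`, whose quantum torus is the completed tensor product of the quantum torus of
`Ξ` with the smooth functions on `U(1)`; its last generator is the function `z` on `U(1)`, which
commutes with everything. -/
def extMat (Ξ : Matrix (Fin m) (Fin m) ℝ) : Matrix (Fin (m + 1)) (Fin (m + 1)) ℝ :=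
  Matrix.of fun i j =>
    Fin.lastCases (motive := fun _ => ℝ) 0
      (fun i' => Fin.lastCases (motive := fun _ => ℝ) 0 (fun j' => Ξ i' j') j) i

lemma twist_extMat (r s : Fin m → ℤ) (x y : ℤ) :
    twist (extMat Ξ) (snoc r x) (snoc s y) = twist Ξ r s := by
  have h : phase (extMat Ξ) (snoc r x) (snoc s y) = phase Ξ r s := by
    simp [phase, Fin.sum_univ_castSucc, extMat, Fin.castSucc_lt_castSucc_iff]
  simp [twist, h]

lemma IsRapid.push {a : (Fin m → ℤ) → ℂ} (ha : IsRapid a) (c : (Fin m → ℤ) →+ ℤ)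
    (hc : ∀ r, ‖c r‖ ≤ ‖r‖) :
    IsRapid fun t : Fin (m + 1) → ℤ => if t (Fin.last m) = c (init t) then a (init t) else 0 := by
  intro k
  obtain ⟨C, hC⟩ := ha k
  have hC0 : 0 ≤ C := le_trans (by positivity) (hC 0)
  refine ⟨C, fun t => ?_⟩
  beta_reduce
  split_ifs with h
  · have h1 : ‖t‖ ≤ ‖init t‖ := by
      refine (norm_le_max t).trans (max_le le_rfl ?_)
      rw [h]; exact hc _
    refine le_trans ?_ (hC (init t))
    gcongr
  · simpa using hC0

/-- The linear map `u^r ↦ u^r w^{c(r)}` into a quantum torus with one more generator `w`. -/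
def push (c : (Fin m → ℤ) →+ ℤ) (hc : ∀ r, ‖c r‖ ≤ ‖r‖) (Ξ : Matrix (Fin m) (Fin m) ℝ)
    (Ξ' : Matrix (Fin (m + 1)) (Fin (m + 1)) ℝ) : QTorus Ξ →ₗ[ℂ] QTorus Ξ' where
  toFun a := ofRapid Ξ' (fun t => if t (Fin.last m) = c (init t) then coeff a (init t) else 0)
    ((coeff_rapid a).push c hc)
  map_add' a b := by
    ext t
    simp only [coeff_add, Pi.add_apply, coeff_ofRapid]
    split_ifs <;> simp
  map_smul' x a := by
    ext t
    simp only [coeff_smul, Pi.smul_apply, RingHom.id_apply, coeff_ofRapid]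
    split_ifs <;> simp

lemma coeff_push (c : (Fin m → ℤ) →+ ℤ) (hc : ∀ r, ‖c r‖ ≤ ‖r‖)
    (Ξ' : Matrix (Fin (m + 1)) (Fin (m + 1)) ℝ) (a : QTorus Ξ) (t : Fin (m + 1) → ℤ) :
    coeff (push c hc Ξ Ξ' a) t = if t (Fin.last m) = c (init t) then coeff a (init t) else 0 := rfl

lemma push_mul (c : (Fin m → ℤ) →+ ℤ) (hc : ∀ r, ‖c r‖ ≤ ‖r‖)
    (Ξ' : Matrix (Fin (m + 1)) (Fin (m + 1)) ℝ)
    (h : ∀ r s, twist Ξ' (snoc r (c r)) (snoc s (c s)) = twist Ξ r s) (a b : QTorus Ξ) :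
    push c hc Ξ Ξ' (a * b) = push c hc Ξ Ξ' a * push c hc Ξ Ξ' b := by
  ext t
  have hinit : ∀ r, init (t - r) = init t - init r := fun r => rfl
  rw [coeff_push, coeff_mul, coeff_mul]
  split_ifs with ht
  · have hinj : Function.Injective fun s : Fin m → ℤ => snoc s (c s) := fun s s' hs => by
      have := congrArg init hs
      simpa using this
    rw [← hinj.tsum_eq]
    · refine tsum_congr fun s => ?_
      have h1 : t - snoc s (c s) = snoc (init t - s) (c (init t - s)) := by
        rw [map_sub, ← ht]
        funext i
        refine Fin.lastCases ?_ (fun j => ?_) i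
        · simp
        · simp [init]
      simp only [h1, coeff_push, snoc_last, init_snoc, if_true, h]
    · intro r hr
      refine ⟨init r, ?_⟩
      have : r (Fin.last m) = c (init r) := by
        by_contra hne
        exact hr (by simp [coeff_push, hne])
      show snoc (init r) (c (init r)) = r
      rw [← this, snoc_init]
  · symm
    refine (tsum_congr fun r => ?_).trans tsum_zero
    rw [coeff_push, coeff_push]
    by_cases h1 : r (Fin.last m) = c (init r)
    · rw [if_neg (c := (t - r) (Fin.last m) = c (init (t - r)))]
      · simp
      · rw [hinit, map_sub, Pi.sub_apply, h1]
        intro h2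
        exact ht (sub_left_injective h2)
    · simp [h1]

/-- The Hopf algebra of polynomial functions on `U(1)`; `T 1` is the coordinate `z`. -/
abbrev G : Type := LaurentPolynomial ℂ

/-- The elementary tensor `p ⊗ g` in the completed tensor product. -/
def tens (Ξ : Matrix (Fin m) (Fin m) ℝ) : QTorus Ξ →ₗ[ℂ] G →ₗ[ℂ] QTorus (extMat Ξ) :=
  LinearMap.mk₂ ℂ (fun p g => ofRapid (extMat Ξ) (fun t => coeff p (init t) * g.coeff (t (Fin.last m)))
    fun k => by
      obtain ⟨C, hC⟩ := coeff_rapid p k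
      have hC0 : 0 ≤ C := le_trans (by positivity) (hC 0)
      refine ⟨C * ∑ z ∈ g.coeff.support, (1 + ‖z‖) ^ k * ‖g.coeff z‖, fun t => ?_⟩
      have h1 : 1 + ‖t‖ ≤ (1 + ‖init t‖) * (1 + ‖t (Fin.last m)‖) := by
        have := norm_le_max t
        have h2 := norm_nonneg (init t)
        have h3 := norm_nonneg (t (Fin.last m))
        have h4 : max ‖init t‖ ‖t (Fin.last m)‖ ≤ ‖init t‖ + ‖t (Fin.last m)‖ :=
          max_le (by linarith) (by linarith)
        nlinarith [mul_nonneg h2 h3]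
      have h2 : (1 + ‖t (Fin.last m)‖) ^ k * ‖g.coeff (t (Fin.last m))‖
          ≤ ∑ z ∈ g.coeff.support, (1 + ‖z‖) ^ k * ‖g.coeff z‖ := by
        by_cases h : t (Fin.last m) ∈ g.coeff.support
        · exact Finset.single_le_sum (f := fun z : ℤ => (1 + ‖z‖) ^ k * ‖g.coeff z‖)
            (fun _ _ => by positivity) h
        · rw [Finsupp.notMem_support_iff.mp h]
          simp only [norm_zero, mul_zero]
          exact Finset.sum_nonneg fun _ _ => by positivity
      calc (1 + ‖t‖) ^ k * ‖coeff p (init t) * g.coeff (t (Fin.last m))‖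
          ≤ ((1 + ‖init t‖) * (1 + ‖t (Fin.last m)‖)) ^ k
            * ‖coeff p (init t) * g.coeff (t (Fin.last m))‖ := by gcongr
        _ = ((1 + ‖init t‖) ^ k * ‖coeff p (init t)‖)
            * ((1 + ‖t (Fin.last m)‖) ^ k * ‖g.coeff (t (Fin.last m))‖) := by
            rw [norm_mul, mul_pow]; ring
        _ ≤ _ := by
            gcongr
            exact hC _)
    (fun p p' g => by ext t; exact add_mul _ _ _)
    (fun c p g => by ext t; exact mul_assoc _ _ _)
    (fun p g g' => by ext t; exact mul_add _ _ _)
    (fun c p g => by ext t; exact mul_left_comm _ _ _)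

lemma coeff_tens (p : QTorus Ξ) (g : G) (t : Fin (m + 1) → ℤ) :
    coeff (tens Ξ p g) t = coeff p (init t) * g.coeff (t (Fin.last m)) := rfl

/-! ### The quantum principal bundle -/

/-- The parameter matrix of the base space: the block of the first `n` generators. -/
def baseMat (Ξ : Matrix (Fin (n + 1)) (Fin (n + 1)) ℝ) : Matrix (Fin n) (Fin n) ℝ :=
  Ξ.submatrix Fin.castSucc Fin.castSucc

lemma twist_baseMat (Ξ : Matrix (Fin (n + 1)) (Fin (n + 1)) ℝ) (r s : Fin n → ℤ) :
    twist Ξ (snoc r 0) (snoc s 0) = twist (baseMat Ξ) r s := by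
  have h : phase Ξ (snoc r 0) (snoc s 0) = phase (baseMat Ξ) r s := by
    simp [phase, Fin.sum_univ_castSucc, baseMat, Fin.castSucc_lt_castSucc_iff]
  simp [twist, h]

/-- The inclusion of the base algebra, `u_j ↦ u_j` for `j ≤ n`. -/
def incl (Ξ : Matrix (Fin (n + 1)) (Fin (n + 1)) ℝ) : QTorus (baseMat Ξ) →ₗ[ℂ] QTorus Ξ :=
  push 0 (fun r => by simp) (baseMat Ξ) Ξ

lemma incl_mul (Ξ : Matrix (Fin (n + 1)) (Fin (n + 1)) ℝ) (a b : QTorus (baseMat Ξ)) :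
    incl Ξ (a * b) = incl Ξ a * incl Ξ b :=
  push_mul 0 _ Ξ (fun r s => twist_baseMat Ξ r s) a b

/-- The indices below the last one which belong to `K`. -/
def lower (K : Finset (Fin (m + 1))) : Finset (Fin m) :=
  Finset.univ.filter fun i => i.castSucc ∈ K

/-- The inclusion of the forms of the base space, `dU_j ↦ dU_j` for `j ≤ n`. -/
def inclForm (Ξ : Matrix (Fin (n + 1)) (Fin (n + 1)) ℝ) : Forms (baseMat Ξ) →ₗ[ℂ] Forms Ξ where
  toFun μ := fun K => if Fin.last n ∈ K then 0 else incl Ξ (μ (lower K))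
  map_add' μ ν := by ext1 K; by_cases h : Fin.last n ∈ K <;> simp [h]
  map_smul' c μ := by ext1 K; by_cases h : Fin.last n ∈ K <;> simp [h]

/-- The coaction `Δ_P`: `u_j ↦ u_j ⊗ 1` for `j ≤ n` and `u_{n+1} ↦ u_{n+1} ⊗ z`. -/
def coact (Ξ : Matrix (Fin (n + 1)) (Fin (n + 1)) ℝ) : QTorus Ξ →ₗ[ℂ] QTorus (extMat Ξ) :=
  push (Pi.evalAddMonoidHom (fun _ : Fin (n + 1) => ℤ) (Fin.last n))
    (fun r => norm_le_pi_norm r (Fin.last n)) Ξ (extMat Ξ)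

lemma coact_mul (Ξ : Matrix (Fin (n + 1)) (Fin (n + 1)) ℝ) (a b : QTorus Ξ) :
    coact Ξ (a * b) = coact Ξ a * coact Ξ b :=
  push_mul _ _ _ (fun r s => twist_extMat r s _ _) a b

/-- The extension of the coaction to forms. It is multiplicative, equal to `Δ_P` on the algebra,
`dU_j ↦ dU_j ⊗ 1` for `j ≤ n` and `dU_{n+1} ↦ dU_{n+1} ⊗ 1 + 1 ⊗ dU`, where `dU` is the last basis
form, belonging to `z`; the latter means `du_{n+1} ↦ du_{n+1} ⊗ z + u_{n+1} ⊗ dz`. -/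
def coactForm (Ξ : Matrix (Fin (n + 1)) (Fin (n + 1)) ℝ) : Forms Ξ →ₗ[ℂ] Forms (extMat Ξ) where
  toFun μ := fun K =>
    if Fin.last (n + 1) ∈ K then
      if Fin.last n ∈ lower K then 0 else coact Ξ (μ (insert (Fin.last n) (lower K)))
    else coact Ξ (μ (lower K))
  map_add' μ ν := by ext1 K; dsimp only [Pi.add_apply]; split_ifs <;> simp
  map_smul' c μ := by ext1 K; dsimp only [Pi.smul_apply]; split_ifs <;> simp

/-- The elementary tensor `μ ⊗ g` of a form and a function on `U(1)`. -/
def tensForm (Ξ : Matrix (Fin m) (Fin m) ℝ) : Forms Ξ →ₗ[ℂ] G →ₗ[ℂ] Forms (extMat Ξ) :=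
  LinearMap.mk₂ ℂ (fun μ g => fun K => if Fin.last m ∈ K then 0 else tens Ξ (μ (lower K)) g)
    (fun μ ν g => by ext1 K; by_cases h : Fin.last m ∈ K <;> simp [h])
    (fun c μ g => by ext1 K; by_cases h : Fin.last m ∈ K <;> simp [h])
    (fun μ g g' => by ext1 K; by_cases h : Fin.last m ∈ K <;> simp [h])
    (fun c μ g => by ext1 K; by_cases h : Fin.last m ∈ K <;> simp [h])

/-! ### The classical calculus on `U(1)` -/

/-- The right adjoint coaction `Ad(g) = g^{(2)} ⊗ S(g^{(1)}) g^{(3)}`. -/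
def Ad : G →ₗ[ℂ] G ⊗[ℂ] G :=
  (LinearMap.lTensor G ((LinearMap.mul' ℂ G).comp
    (LinearMap.rTensor G (HopfAlgebra.antipode ℂ)))).comp
    ((TensorProduct.leftComm ℂ G G G).toLinearMap.comp
      ((LinearMap.lTensor G (Coalgebra.comul (R := ℂ))).comp (Coalgebra.comul (R := ℂ))))

/-- The kernel of the counit. -/
abbrev augIdeal : Ideal G := RingHom.ker (Bialgebra.counitAlgHom ℂ G)

/-- The dual `Ker ε / (Ker ε)^2` of the complexified quantum Lie algebra of `U(1)`. -/
abbrev U1Dual : Type := augIdeal.Cotangent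

/-- The map `g ↦ g - ε(g) 1` onto the kernel of the counit. -/
def augProj : G →ₗ[ℂ] augIdeal where
  toFun g := ⟨g - algebraMap ℂ G (Coalgebra.counit (R := ℂ) g), by
    simp [RingHom.mem_ker, Bialgebra.counitAlgHom_apply]⟩
  map_add' a b := by ext1; simp; ring
  map_smul' c a := by
    ext1
    simp [Algebra.smul_def, mul_sub]

/-- The quantum germs map `π(g) = i [g - ε(g) 1]`. -/
def germs : G →ₗ[ℂ] U1Dual :=
  Complex.I • (augIdeal.toCotangent.restrictScalars ℂ).comp augProj

/-- The generator `ϑ = π(z)`. -/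
def theta : U1Dual := germs (LaurentPolynomial.T 1)

lemma Ad_apply (g : G) : Ad g = g ⊗ₜ[ℂ] (1 : G) := by
  induction g using LaurentPolynomial.induction_on' with
  | add p q hp hq => rw [map_add, hp, hq, TensorProduct.add_tmul]
  | C_mul_T k a =>
    rw [← LaurentPolynomial.smul_eq_C_mul, map_smul, ← TensorProduct.smul_tmul']
    congr 1
    simp only [Ad, LinearMap.comp_apply, LaurentPolynomial.comul_T, LinearMap.lTensor_tmul,
      LinearEquiv.coe_coe, TensorProduct.leftComm_tmul, LinearMap.rTensor_tmul,
      LinearMap.mul'_apply, LaurentPolynomial.antipode_T, ← LaurentPolynomial.T_add,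
      neg_add_cancel, LaurentPolynomial.T_zero]

lemma germs_of_mem (x : augIdeal) : germs x = Complex.I • augIdeal.toCotangent x := by
  have hx : Coalgebra.counit (R := ℂ) (x : G) = 0 := x.2
  have : augProj x = x := by ext1; simp [augProj, hx]
  simp [germs, this]

/-- The corepresentation `ad`, with `ad ∘ π = (π ⊗ id) ∘ Ad`. -/
def ad : U1Dual →ₗ[ℂ] U1Dual ⊗[ℂ] G :=
  Ideal.Cotangent.lift
    ((-Complex.I) • ((LinearMap.rTensor G germs).comp Ad).comp
      (augIdeal.subtype.restrictScalars ℂ))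
    (fun x y => by
      have h : augIdeal.toCotangent (x * y) = 0 := by
        rw [Ideal.toCotangent_eq_zero, pow_two]
        exact Ideal.mul_mem_mul x.2 y.2
      have h2 : germs ((x * y : augIdeal) : G) = 0 := by rw [germs_of_mem, h, smul_zero]
      have h3 : ((x * y : augIdeal) : G) = (x : G) * (y : G) := rfl
      show (-Complex.I) • (LinearMap.rTensor G germs) (Ad ((x * y : augIdeal) : G)) = 0
      rw [Ad_apply, LinearMap.rTensor_tmul, h2, TensorProduct.zero_tmul, smul_zero])

lemma ad_apply (θ : U1Dual) : ad θ = θ ⊗ₜ[ℂ] (1 : G) := by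
  obtain ⟨x, rfl⟩ := augIdeal.toCotangent_surjective θ
  show (-Complex.I) • (LinearMap.rTensor G germs) (Ad (x : G)) = _
  rw [Ad_apply, LinearMap.rTensor_tmul, germs_of_mem, TensorProduct.smul_tmul', smul_smul]
  simp

/-- The involution of the polynomial functions on `U(1)`: `z^* = z^{-1}`, antilinear. -/
def starG : G →+* G :=
  (LaurentPolynomial.invert : G ≃ₐ[ℂ] G).toRingHom.comp
    (AddMonoidAlgebra.mapRingHom ℤ (starRingEnd ℂ))

/-- The ring endomorphism `g ↦ S(g)^*`. -/
def starAntipode : G →+* G := starG.comp (HopfAlgebra.antipodeAlgHom ℂ G).toRingHom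

lemma counit_starAntipode (g : G) : Coalgebra.counit (R := ℂ) (starAntipode g)
    = (starRingEnd ℂ) (Coalgebra.counit (R := ℂ) g) := by
  induction g using LaurentPolynomial.induction_on' with
  | add p q hp hq => rw [map_add, map_add, hp, hq, map_add, map_add]
  | C_mul_T k a =>
    rw [← LaurentPolynomial.single_eq_C_mul_T]
    simp [starAntipode, starG, -LaurentPolynomial.single_eq_C_mul_T, LaurentPolynomial.invert]

/-- The involution with `π(g)^* = π(S(g)^*)`, that is `[g]^* = -[S(g)^*]`. -/
def starDual (θ : U1Dual) : U1Dual :=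
  -Ideal.mapCotangent augIdeal augIdeal starAntipode.toIntAlgHom (fun x hx => by
    have h : Coalgebra.counit (R := ℂ) x = 0 := hx
    show Coalgebra.counit (R := ℂ) (starAntipode x) = 0
    rw [counit_starAntipode, h, map_zero]) θ

/-- The derivative `g ↦ ∑ k g_k` at the unit element. -/
def derivOne : G →ₗ[ℂ] ℂ :=
  (Finsupp.linearCombination ℂ (fun k : ℤ => (k : ℂ))).comp
    (AddMonoidAlgebra.coeffLinearEquiv ℂ).toLinearMap

lemma derivOne_single (k : ℤ) (x : ℂ) : derivOne (AddMonoidAlgebra.single k x) = x * k := by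
  simp [derivOne, -LaurentPolynomial.single_eq_C_mul_T]

lemma derivOne_mul (a b : G) : derivOne (a * b)
    = derivOne a * Coalgebra.counit (R := ℂ) b + Coalgebra.counit (R := ℂ) a * derivOne b := by
  induction a using LaurentPolynomial.induction_on' with
  | add p q hp hq => simp only [add_mul, map_add, hp, hq]; ring
  | C_mul_T k x =>
    induction b using LaurentPolynomial.induction_on' with
    | add p q hp hq => simp only [mul_add, map_add, hp, hq]; ring
    | C_mul_T l y =>
      have h : LaurentPolynomial.C x * LaurentPolynomial.T k *
          (LaurentPolynomial.C y * LaurentPolynomial.T l)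
          = (LaurentPolynomial.C (x * y) * LaurentPolynomial.T (k + l) : G) := by
        rw [LaurentPolynomial.T_add, map_mul]; ring
      rw [h]
      simp only [← LaurentPolynomial.single_eq_C_mul_T, derivOne_single]
      simp [-LaurentPolynomial.single_eq_C_mul_T]
      ring

/-- The linear functional `κ` with `κ(ϑ) = 1`, that is `κ([g]) = -i ∑ k g_k`. -/
def kappa : U1Dual →ₗ[ℂ] ℂ :=
  Ideal.Cotangent.lift
    ((-Complex.I) • derivOne.comp (augIdeal.subtype.restrictScalars ℂ))
    (fun x y => by
      have hx : Coalgebra.counit (R := ℂ) (x : G) = 0 := x.2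
      have hy : Coalgebra.counit (R := ℂ) (y : G) = 0 := y.2
      show (-Complex.I) • derivOne ((x : G) * (y : G)) = 0
      rw [derivOne_mul, hx, hy]
      simp)

/-- The left-invariant form `1 ⊗ π(g) = ∑ 1 ⊗ S(g^{(1)}) d(g^{(2)})`. -/
def invForm (Ξ : Matrix (Fin m) (Fin m) ℝ) : G →ₗ[ℂ] Forms (extMat Ξ) :=
  (TensorProduct.lift (LinearMap.mk₂ ℂ
    (fun a b => tens Ξ 1 (HopfAlgebra.antipode ℂ a) • d (of (tens Ξ 1 b)))
    (fun a a' b => by simp [add_smul])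
    (fun c a b => by simp)
    (fun a b b' => by simp [smul_add])
    (fun c a b => by simp only [map_smul]; rw [smul_comm]))).comp (Coalgebra.comul (R := ℂ))

/-- A (real) quantum principal connection. -/
structure QPC (Ξ : Matrix (Fin (n + 1)) (Fin (n + 1)) ℝ) where
  /-- The underlying linear map. -/
  toLin : U1Dual →ₗ[ℂ] Forms Ξ
  degree_one : ∀ θ, toLin θ ∈ degreePart Ξ 1
  coaction : ∀ g : G, coactForm Ξ (toLin (germs g))
    = TensorProduct.lift ((tensForm Ξ).comp toLin) (ad (germs g)) + invForm Ξ g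
  real : ∀ θ, toLin (starDual θ) = star (toLin θ)

/-! ### Covariant derivatives -/

lemma IsRapid.slice {a : (Fin (m + 1) → ℤ) → ℂ} (ha : IsRapid a) (k : ℤ) :
    IsRapid fun r => a (snoc r k) := by
  intro l
  obtain ⟨C, hC⟩ := ha l
  refine ⟨C, fun r => le_trans ?_ (hC (snoc r k))⟩
  have h : ‖r‖ ≤ ‖snoc r k‖ := by simpa using norm_init_le (snoc r k)
  gcongr

/-- The coefficient `x_k` of `x = ∑_k x_k ⊗ z^k`. -/
def slice (k : ℤ) (x : QTorus (extMat Ξ)) : QTorus Ξ :=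
  ofRapid Ξ (fun r => coeff x (snoc r k)) ((coeff_rapid x).slice k)

/-- The coefficient `ψ_k` of `ψ = ∑_k ψ_k ⊗ z^k`, for forms without component along `U(1)`. -/
def sliceForm (k : ℤ) (ψ : Forms (extMat Ξ)) : Forms Ξ :=
  fun I => slice k (ψ (I.map Fin.castSuccEmb))

/-- The covariant derivative `D^ω φ = dφ - (-1)^k φ^{(0)} ω(π(φ^{(1)}))` of a horizontal form `φ`
of degree `k`, where `φ^{(0)} ⊗ φ^{(1)}` is the image of `φ` under the coaction. -/
def covD {Ξ : Matrix (Fin (n + 1)) (Fin (n + 1)) ℝ} (ω : QPC Ξ) (φ : Forms Ξ) : Forms Ξ :=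
  d φ - ∑' k : ℤ, wedge (gradeInv (sliceForm k (coactForm Ξ φ)))
    (ω.toLin (germs (LaurentPolynomial.T k)))

/-- The dual covariant derivative `- * ∘ D^ω ∘ *`. -/
def covDhat {Ξ : Matrix (Fin (n + 1)) (Fin (n + 1)) ℝ} (ω : QPC Ξ) (φ : Forms Ξ) : Forms Ξ :=
  -star (covD ω (star φ))

/-! ### The associated bundle of the adjoint corepresentation -/

/-- The intertwiners between `ad` and `Δ_P`. -/
def intertwiners (Ξ : Matrix (Fin (n + 1)) (Fin (n + 1)) ℝ) :
    Submodule ℂ (U1Dual →ₗ[ℂ] QTorus Ξ) where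
  carrier := {T | ∀ θ, coact Ξ (T θ) = TensorProduct.lift ((tens Ξ).comp T) (ad θ)}
  zero_mem' := fun θ => by simp [ad_apply]
  add_mem' := fun {S T} hS hT θ => by
    have h1 := hS θ
    have h2 := hT θ
    rw [ad_apply] at h1 h2 ⊢
    simp only [TensorProduct.lift.tmul, LinearMap.comp_apply, LinearMap.add_apply, map_add]
      at h1 h2 ⊢
    rw [h1, h2]
  smul_mem' := fun c T hT θ => by
    have h1 := hT θ
    rw [ad_apply] at h1 ⊢
    simp only [TensorProduct.lift.tmul, LinearMap.comp_apply, LinearMap.smul_apply, map_smul]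
      at h1 ⊢
    rw [h1]

/-- The associated right module: the intertwiners between `ad` and `Δ_P`. -/
def E (Ξ : Matrix (Fin (n + 1)) (Fin (n + 1)) ℝ) : Type := ↥(intertwiners Ξ)

instance (Ξ : Matrix (Fin (n + 1)) (Fin (n + 1)) ℝ) : AddCommGroup (E Ξ) :=
  inferInstanceAs (AddCommGroup (intertwiners Ξ))

instance (Ξ : Matrix (Fin (n + 1)) (Fin (n + 1)) ℝ) : Module ℂ (E Ξ) :=
  inferInstanceAs (Module ℂ (intertwiners Ξ))

/-- The linear map underlying an intertwiner. -/
def E.toLin {Ξ : Matrix (Fin (n + 1)) (Fin (n + 1)) ℝ} : E Ξ →ₗ[ℂ] U1Dual →ₗ[ℂ] QTorus Ξ :=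
  (intertwiners Ξ).subtype

/-- The intertwiner with given underlying linear map. -/
def E.mk {Ξ : Matrix (Fin (n + 1)) (Fin (n + 1)) ℝ} (T : U1Dual →ₗ[ℂ] QTorus Ξ)
    (hT : T ∈ intertwiners Ξ) : E Ξ := ⟨T, hT⟩

@[simp] lemma E.toLin_mk {Ξ : Matrix (Fin (n + 1)) (Fin (n + 1)) ℝ} (T : U1Dual →ₗ[ℂ] QTorus Ξ)
    (hT : T ∈ intertwiners Ξ) : E.toLin (E.mk T hT) = T := rfl

lemma E.toLin_mem {Ξ : Matrix (Fin (n + 1)) (Fin (n + 1)) ℝ} (T : E Ξ) :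
    E.toLin T ∈ intertwiners Ξ := T.2

lemma E.ext {Ξ : Matrix (Fin (n + 1)) (Fin (n + 1)) ℝ} {S T : E Ξ}
    (h : ∀ θ, E.toLin S θ = E.toLin T θ) : S = T := Subtype.ext (LinearMap.ext h)

lemma tens_one (p : QTorus Ξ) :
    tens Ξ p 1 = push 0 (fun r => by simp) Ξ (extMat Ξ) p := by
  ext t
  rw [coeff_tens, coeff_push]
  by_cases h : t (Fin.last m) = 0
  · simp [h, AddMonoidAlgebra.one_def, -LaurentPolynomial.single_eq_C_mul_T]
  · simp [h, AddMonoidAlgebra.one_def, -LaurentPolynomial.single_eq_C_mul_T]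

lemma tens_one_mul (p q : QTorus Ξ) : tens Ξ (p * q) 1 = tens Ξ p 1 * tens Ξ q 1 := by
  rw [tens_one, tens_one, tens_one]
  exact push_mul 0 _ _ (fun r s => twist_extMat r s _ _) p q

lemma coeff_coact (Ξ : Matrix (Fin (n + 1)) (Fin (n + 1)) ℝ) (a : QTorus Ξ)
    (t : Fin (n + 1 + 1) → ℤ) : coeff (coact Ξ a) t
      = if t (Fin.last (n + 1)) = init t (Fin.last n) then coeff a (init t) else 0 := rfl

lemma coact_incl (Ξ : Matrix (Fin (n + 1)) (Fin (n + 1)) ℝ) (b : QTorus (baseMat Ξ)) :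
    coact Ξ (incl Ξ b) = tens Ξ (incl Ξ b) 1 := by
  ext t
  rw [tens_one, coeff_coact, coeff_push, incl, coeff_push]
  by_cases h : init t (Fin.last n) = 0
  · simp [h]
  · simp [h]

/-- The right multiplication `(T b)(θ) = T(θ) b` by elements of the base algebra. -/
def E.mulBase {Ξ : Matrix (Fin (n + 1)) (Fin (n + 1)) ℝ} :
    E Ξ →ₗ[ℂ] QTorus (baseMat Ξ) →ₗ[ℂ] E Ξ :=
  LinearMap.mk₂ ℂ
    (fun T b => E.mk ((LinearMap.mulRight ℂ (incl Ξ b)).comp (E.toLin T)) fun θ => by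
      have h := E.toLin_mem T θ
      rw [ad_apply] at h ⊢
      simp only [TensorProduct.lift.tmul, LinearMap.comp_apply, LinearMap.mulRight_apply] at h ⊢
      rw [coact_mul, h, coact_incl, tens_one_mul])
    (fun T T' b => E.ext fun θ => add_mul (E.toLin T θ) (E.toLin T' θ) (incl Ξ b))
    (fun c T b => E.ext fun θ => smul_mul_assoc c (E.toLin T θ) (incl Ξ b))
    (fun T b b' => E.ext fun θ => by
      show E.toLin T θ * incl Ξ (b + b') = E.toLin T θ * incl Ξ b + E.toLin T θ * incl Ξ b'
      rw [map_add, mul_add])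
    (fun c T b => E.ext fun θ => by
      show E.toLin T θ * incl Ξ (c • b) = c • (E.toLin T θ * incl Ξ b)
      rw [map_smul, mul_smul_comm])

lemma E.mulBase_apply {Ξ : Matrix (Fin (n + 1)) (Fin (n + 1)) ℝ} (T : E Ξ)
    (b : QTorus (baseMat Ξ)) (θ : U1Dual) : E.toLin (E.mulBase T b) θ = E.toLin T θ * incl Ξ b := rfl

/-- The relations `T b ⊗ μ = T ⊗ b μ` which define the tensor product over the base algebra. -/
def balanced (Ξ : Matrix (Fin (n + 1)) (Fin (n + 1)) ℝ) :
    Submodule ℂ (E Ξ ⊗[ℂ] Forms (baseMat Ξ)) :=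
  Submodule.span ℂ {x | ∃ (T : E Ξ) (b : QTorus (baseMat Ξ)) (μ : Forms (baseMat Ξ)),
    x = E.mulBase T b ⊗ₜ[ℂ] μ - T ⊗ₜ[ℂ] (b • μ)}

/-- The tensor product, over the base algebra, of the right module `E Ξ` and the forms of the
base space. -/
abbrev EForms (Ξ : Matrix (Fin (n + 1)) (Fin (n + 1)) ℝ) : Type :=
  (E Ξ ⊗[ℂ] Forms (baseMat Ξ)) ⧸ balanced Ξ

namespace EForms

variable {Ξ : Matrix (Fin (n + 1)) (Fin (n + 1)) ℝ}

/-- The elementary tensor `T ⊗ μ` over the base algebra. -/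
def tmul (T : E Ξ) (μ : Forms (baseMat Ξ)) : EForms Ξ := (balanced Ξ).mkQ (T ⊗ₜ[ℂ] μ)

/-- The linear map `T ⊗ μ ↦ f T μ` determined by a balanced bilinear map. -/
def lift {M : Type*} [AddCommGroup M] [Module ℂ M] (f : E Ξ →ₗ[ℂ] Forms (baseMat Ξ) →ₗ[ℂ] M)
    (hf : ∀ T b μ, f (E.mulBase T b) μ = f T (b • μ)) : EForms Ξ →ₗ[ℂ] M :=
  (balanced Ξ).liftQ (TensorProduct.lift f) (by
    rw [balanced, Submodule.span_le]
    rintro x ⟨T, b, μ, rfl⟩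
    simp [hf])

@[simp] lemma lift_tmul {M : Type*} [AddCommGroup M] [Module ℂ M]
    (f : E Ξ →ₗ[ℂ] Forms (baseMat Ξ) →ₗ[ℂ] M)
    (hf : ∀ T b μ, f (E.mulBase T b) μ = f T (b • μ)) (T : E Ξ) (μ : Forms (baseMat Ξ)) :
    lift f hf (tmul T μ) = f T μ := by
  simp [lift, tmul]

/-- `tmul` as a bilinear map. -/
def tmulₗ : E Ξ →ₗ[ℂ] Forms (baseMat Ξ) →ₗ[ℂ] EForms Ξ :=
  (TensorProduct.mk ℂ (E Ξ) (Forms (baseMat Ξ))).compr₂ (balanced Ξ).mkQ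

@[simp] lemma tmulₗ_apply (T : E Ξ) (μ : Forms (baseMat Ξ)) : tmulₗ T μ = tmul T μ := rfl

lemma mulBase_tmul (T : E Ξ) (b : QTorus (baseMat Ξ)) (μ : Forms (baseMat Ξ)) :
    tmul (E.mulBase T b) μ = tmul T (b • μ) :=
  (Submodule.Quotient.eq _).mpr (Submodule.subset_span ⟨T, b, μ, rfl⟩)

lemma hom_ext {M : Type*} [AddCommGroup M] [Module ℂ M] {f g : EForms Ξ →ₗ[ℂ] M}
    (h : ∀ T μ, f (tmul T μ) = g (tmul T μ)) : f = g :=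
  Submodule.linearMap_qext _ (TensorProduct.ext' h)

lemma induct {p : EForms Ξ → Prop} (x : EForms Ξ) (h : ∀ T μ, p (tmul T μ))
    (h0 : p 0) (hadd : ∀ x y, p x → p y → p (x + y)) : p x := by
  obtain ⟨y, rfl⟩ := (balanced Ξ).mkQ_surjective x
  induction y using TensorProduct.induction_on with
  | zero => simpa using h0
  | tmul T μ => exact h T μ
  | add a b ha hb => rw [map_add]; exact hadd _ _ ha hb

lemma smul_wedge (b : QTorus (baseMat Ξ)) (μ ν : Forms (baseMat Ξ)) :
    wedge (b • μ) ν = b • wedge μ ν := by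
  ext1 K
  rw [Pi.smul_apply, wedge_apply, wedge_apply, Finset.smul_sum]
  refine Finset.sum_congr rfl fun I _ => ?_
  rw [Pi.smul_apply, smul_eq_mul, smul_eq_mul, mul_smul_comm, mul_assoc]

/-- The right multiplication `(T ⊗ μ) ν = T ⊗ μ ν`. -/
def mulForm : Forms (baseMat Ξ) →ₗ[ℂ] EForms Ξ →ₗ[ℂ] EForms Ξ where
  toFun ν := lift (tmulₗ.compl₂ (wedge.flip ν)) fun T b μ => by
    simp only [LinearMap.compl₂_apply, LinearMap.flip_apply, tmulₗ_apply, smul_wedge, mulBase_tmul]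
  map_add' ν ν' := hom_ext fun T μ => by
    simp only [lift_tmul, LinearMap.add_apply, LinearMap.compl₂_apply, LinearMap.flip_apply,
      map_add]
  map_smul' c ν := hom_ext fun T μ => by
    simp only [lift_tmul, LinearMap.smul_apply, LinearMap.compl₂_apply, LinearMap.flip_apply,
      map_smul, RingHom.id_apply]

@[simp] lemma mulForm_tmul (T : E Ξ) (μ ν : Forms (baseMat Ξ)) :
    mulForm ν (tmul T μ) = tmul T (wedge μ ν) := by simp [mulForm]

lemma mulForm_mulForm (b : QTorus (baseMat Ξ)) (μ : Forms (baseMat Ξ)) (x : EForms Ξ) :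
    mulForm μ (mulForm (of b) x) = mulForm (b • μ) x := by
  induction x using induct with
  | h T ν => simp [wedge_balanced]
  | h0 => simp
  | hadd x y hx hy => simp only [map_add, hx, hy]

/-- The subspace of elements of degree `k`. -/
def degreePart (Ξ : Matrix (Fin (n + 1)) (Fin (n + 1)) ℝ) (k : ℕ) : Submodule ℂ (EForms Ξ) :=
  Submodule.span ℂ {x | ∃ (T : E Ξ) (μ : Forms (baseMat Ξ)),
    μ ∈ QuantumTorus.degreePart (baseMat Ξ) k ∧ x = tmul T μ}

/-- The map `T ⊗ μ ↦ T μ` into the linear maps from `u(1)^#` to the forms, where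
`(T μ)(θ) = T(θ) μ`. -/
def eval : EForms Ξ →ₗ[ℂ] U1Dual →ₗ[ℂ] Forms Ξ :=
  lift (LinearMap.mk₂ ℂ
    (fun T μ => (LinearMap.toSpanSingleton (QTorus Ξ) (Forms Ξ) (inclForm Ξ μ)).restrictScalars ℂ
      ∘ₗ E.toLin T)
    (fun T T' μ => by ext1 θ; simp [add_smul])
    (fun c T μ => by ext1 θ; simp)
    (fun T μ μ' => by ext1 θ; simp)
    (fun c T μ => by
      ext1 θ
      show E.toLin T θ • inclForm Ξ (c • μ) = c • (E.toLin T θ • inclForm Ξ μ)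
      rw [map_smul, smul_comm])) fun T b μ => by
      ext1 θ
      ext1 K
      show (E.toLin T θ * incl Ξ b) * inclForm Ξ μ K = E.toLin T θ * inclForm Ξ (b • μ) K
      simp only [inclForm, LinearMap.coe_mk, AddHom.coe_mk, Pi.smul_apply, smul_eq_mul]
      split_ifs
      · simp
      · rw [incl_mul, mul_assoc]

lemma eval_tmul (T : E Ξ) (μ : Forms (baseMat Ξ)) (θ : U1Dual) :
    eval (tmul T μ) θ = E.toLin T θ • inclForm Ξ μ := by simp [eval]

/-- The operator `id ⊗ ⋆`. -/
def hodge : EForms Ξ →ₗ[ℂ] EForms Ξ :=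
  lift (tmulₗ.compl₂ QuantumTorus.hodge) fun T b μ => by
    have h : QuantumTorus.hodge (b • μ) = b • QuantumTorus.hodge μ := by
      ext1 K
      exact (mul_smul_comm _ _ _).symm
    simp only [LinearMap.compl₂_apply, tmulₗ_apply, h, mulBase_tmul]

end EForms

/-! ### Connections -/

/-- A quantum linear connection: a linear map from `E Ξ` to its tensor product with the forms of
degree `1` which satisfies the right Leibniz rule. -/
structure QLC (Ξ : Matrix (Fin (n + 1)) (Fin (n + 1)) ℝ) where
  /-- The underlying linear map. -/
  toLin : E Ξ →ₗ[ℂ] EForms Ξ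
  degree_one : ∀ T, toLin T ∈ EForms.degreePart Ξ 1
  leibniz : ∀ T b, toLin (E.mulBase T b)
    = EForms.mulForm (of b) (toLin T) + EForms.tmul T (d (of b))

namespace QLC

variable {Ξ : Matrix (Fin (n + 1)) (Fin (n + 1)) ℝ}

/-- The exterior covariant derivative `d^∇(T ⊗ μ) = ∇(T) μ + T ⊗ dμ`. -/
def dExt (nabla : QLC Ξ) : EForms Ξ →ₗ[ℂ] EForms Ξ :=
  EForms.lift ((EForms.mulForm (Ξ := Ξ)).flip.comp nabla.toLin + EForms.tmulₗ.compl₂ d) fun T b μ => by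
    simp only [LinearMap.add_apply, LinearMap.comp_apply, LinearMap.flip_apply,
      LinearMap.compl₂_apply, EForms.tmulₗ_apply, nabla.leibniz, map_add, EForms.mulForm_mulForm,
      EForms.mulForm_tmul, EForms.mulBase_tmul, d_smul]
    rw [add_assoc, ← EForms.tmulₗ_apply, ← EForms.tmulₗ_apply]

/-- The curvature `d^∇ ∘ ∇`. -/
def curvature (nabla : QLC Ξ) : E Ξ →ₗ[ℂ] EForms Ξ := nabla.dExt.comp nabla.toLin

end QLC

/-- The maps from `E Ξ` to its tensor product with forms which are linear over the base algebra
acting from the right. -/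
structure RLin (Ξ : Matrix (Fin (n + 1)) (Fin (n + 1)) ℝ) where
  /-- The underlying linear map. -/
  toLin : E Ξ →ₗ[ℂ] EForms Ξ
  map_mulBase : ∀ T b, toLin (E.mulBase T b) = EForms.mulForm (of b) (toLin T)

/-- The extension `T ⊗ μ ↦ Λ(T) μ`. -/
def RLin.extend {Ξ : Matrix (Fin (n + 1)) (Fin (n + 1)) ℝ} (L : RLin Ξ) :
    EForms Ξ →ₗ[ℂ] EForms Ξ :=
  EForms.lift ((EForms.mulForm (Ξ := Ξ)).flip.comp L.toLin) fun T b μ => by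
    simp only [LinearMap.comp_apply, LinearMap.flip_apply, L.map_mulBase, EForms.mulForm_mulForm]

namespace QLC

variable {Ξ : Matrix (Fin (n + 1)) (Fin (n + 1)) ℝ}

/-- The commutator `[∇, Λ] = d^∇ ∘ Λ - (-1)^k Λ ∘ ∇` for `Λ` of degree `k`. -/
def bracket (nabla : QLC Ξ) (k : ℕ) (L : RLin Ξ) : E Ξ →ₗ[ℂ] EForms Ξ :=
  nabla.dExt.comp L.toLin - ((-1 : ℂ) ^ k) • L.extend.comp nabla.toLin

/-- The analytical Yang-Mills equation `[∇, (id ⊗ ⋆) ∘ R] = 0`, where `R` is the curvature; the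
map `(id ⊗ ⋆) ∘ R` has degree `n - 2`. -/
def IsYangMills (nabla : QLC Ξ) : Prop :=
  ∃ L : RLin Ξ, L.toLin = EForms.hodge.comp nabla.curvature ∧ nabla.bracket (n - 2) L = 0

end QLC

/-- The map `L` is the gauge connection induced by the quantum principal connection `ω`:
`T ↦ Υ (- * ∘ D^ω ∘ * ∘ T)`, where `Υ` is the inverse of `EForms.eval`. -/
def IsGauge {Ξ : Matrix (Fin (n + 1)) (Fin (n + 1)) ℝ} (ω : QPC Ξ)
    (L : E Ξ →ₗ[ℂ] EForms Ξ) : Prop :=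
  ∀ T θ, EForms.eval (L T) θ = covDhat ω (of (E.toLin T θ))

/-- The metric `⟨S, T⟩ = S(ϑ)^* T(ϑ)`, for the inner product on `u(1)^#` with orthonormal
basis `ϑ`. -/
def metric {Ξ : Matrix (Fin (n + 1)) (Fin (n + 1)) ℝ} (S T : E Ξ) : QTorus Ξ :=
  star (E.toLin S theta) * E.toLin T theta

/-- The extension `⟨S, T ⊗ μ⟩ = ⟨S, T⟩ μ` of the metric. -/
def metricRight {Ξ : Matrix (Fin (n + 1)) (Fin (n + 1)) ℝ} (S : E Ξ) (x : EForms Ξ) : Forms Ξ :=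
  star (E.toLin S theta) • EForms.eval x theta

/-- Compatibility with the metric: `⟨S, ∇T⟩ - ⟨∇S, T⟩ = d⟨S, T⟩`, where
`⟨S ⊗ μ, T⟩ = μ^* ⟨S, T⟩ = ⟨T, S ⊗ μ⟩^*`. -/
def QLC.IsCompatible {Ξ : Matrix (Fin (n + 1)) (Fin (n + 1)) ℝ} (nabla : QLC Ξ) : Prop :=
  ∀ S T : E Ξ, metricRight S (nabla.toLin T) - star (metricRight T (nabla.toLin S))
    = d (of (metric S T))

lemma coact_one (Ξ : Matrix (Fin (n + 1)) (Fin (n + 1)) ℝ) : coact Ξ 1 = tens Ξ 1 1 := by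
  ext t
  rw [tens_one, coeff_coact, coeff_push, coeff_one]
  by_cases h : init t = 0
  · simp [h]
  · simp [h]

/-- The intertwiner `T^triv`, `w ϑ ↦ w 1`. -/
def trivSection (Ξ : Matrix (Fin (n + 1)) (Fin (n + 1)) ℝ) : E Ξ :=
  E.mk ((LinearMap.toSpanSingleton ℂ (QTorus Ξ) 1).comp kappa) fun θ => by
    rw [ad_apply]
    simp [coact_one]

/-- The Grassmann connection: `∇ T = T^triv ⊗ db` where `b = T(ϑ)` belongs to the base algebra. -/
def QLC.IsGrassmann {Ξ : Matrix (Fin (n + 1)) (Fin (n + 1)) ℝ} (nabla : QLC Ξ) : Prop :=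
  ∀ T : E Ξ, ∃! b : QTorus (baseMat Ξ), incl Ξ b = E.toLin T theta ∧
    T = E.mulBase (trivSection Ξ) b ∧ nabla.toLin T = EForms.tmul (trivSection Ξ) (d (of b))

end QuantumTorus

end

/-! The gauge field cannot act on sections of the adjoint bundle, because `U(1)` is abelian. Its
Hopf algebra is commutative and cocommutative, so `ad` is trivial (`ad_apply`), and every value of
an intertwiner `T` is coinvariant (`coact_E`), hence lies in the base algebra `B` (`incl_baseProj`).
For `b` in `B` the coaction is `b ⊗ 1`, and the correction term of `D^ω` is `b ω(π(1)) = 0`. Thus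
`D^ω b = db`, whatever `ω` is (`covD_of_incl`). Since `d` anticommutes with the involution on
functions (`neg_star_d_of_star`), the dual derivative of `b` is `db` too.

It remains to see that `T ↦ d ∘ T` comes from exactly one map into the tensor product over `B`. The
space `u(1)^#` is the line spanned by `ϑ`: `π` is a derivation at the unit, so `π(g) = g'(1) ϑ`
(`germs_eq`, `kappa_smul_theta`). Hence `T` is determined by `b = T(ϑ)`, and `E` is the free
`B`-module on `T^triv` (`mulBase_trivSection`). Every element of the tensor product is therefore
some `T^triv ⊗ μ`, and evaluation at `ϑ` recovers `μ`, so `EForms.eval` is injective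
(`EForms.eval_injective`). The candidate `T^triv b ↦ T^triv ⊗ db` has the required image
(`eval_grassmann`), which gives existence and uniqueness in `isGauge_iff`.

The other claims are then properties of `d`. Compatibility with the metric is the Leibniz rule for
`S(ϑ)^* T(ϑ)`. The curvature vanishes because `d 1 = 0` and `d² = 0` on functions, and the
Yang–Mills equation becomes a statement about the zero map. -/

namespace QuantumTorus

section Torus

variable {m : ℕ} {Ξ : Matrix (Fin m) (Fin m) ℝ}

/-! ### The involution and the derivations -/

lemma phase_neg_left (r s : Fin m → ℤ) : phase Ξ (-r) s = -phase Ξ r s := by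
  have h := phase_add_left (Ξ := Ξ) r (-r) s
  rw [add_neg_cancel] at h
  have h0 : phase Ξ 0 s = 0 := by simp [phase]
  linarith

/-- The phase is real and additive in each argument, so changing the sign of one argument inverts a
number of modulus one, which is the same as conjugating it. -/
lemma twist_neg_left (r s : Fin m → ℤ) :
    twist Ξ (-r) s = (starRingEnd ℂ) (twist Ξ r s) := by
  rw [twist, twist, ← Complex.exp_conj, phase_neg_left, map_mul, Complex.conj_ofReal,
    Complex.conj_I]
  congr 1
  push_cast
  ring

lemma twist_mul_conj (r s : Fin m → ℤ) :
    twist Ξ r s * (starRingEnd ℂ) (twist Ξ r s) = 1 := by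
  rw [← twist_neg_left, ← twist_add_left, add_neg_cancel, twist_zero_left]

lemma twist_neg_right (r s : Fin m → ℤ) :
    twist Ξ r (-s) = (starRingEnd ℂ) (twist Ξ r s) := by
  have h : twist Ξ r s * twist Ξ r (-s) = 1 := by
    rw [← twist_add_right, add_neg_cancel, twist_zero_right]
  have h' := twist_mul_conj (Ξ := Ξ) r s
  exact mul_left_cancel₀ (left_ne_zero_of_mul_eq_one h) (h.trans h'.symm)

lemma twist_neg_neg (r s : Fin m → ℤ) : twist Ξ (-r) (-s) = twist Ξ r s := by
  rw [twist_neg_left, twist_neg_right, Complex.conj_conj]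

/-- Applying the involution twice produces the factor `twist Ξ r r` and the conjugate of `twist Ξ
(-r) (-r)`. The twist is unchanged when both arguments change sign, so the two factors cancel. -/
lemma star_star_qtorus (a : QTorus Ξ) : star (star a) = a := by
  ext r
  rw [coeff_star, coeff_star, neg_neg, map_mul, Complex.conj_conj, twist_neg_neg, mul_assoc,
    mul_comm ((starRingEnd ℂ) _), twist_mul_conj, mul_one]

lemma star_mul_qtorus (a b : QTorus Ξ) : star (a * b) = star b * star a := by
  ext t
  rw [coeff_star, coeff_mul, coeff_mul, Complex.conj_tsum, ← tsum_mul_right]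
  -- Shifting the summation index by `t` turns the factor of `b` on the left into its coefficient at
  -- `-r`, which matches the sum on the right term by term. With `t = r + s` the factor of `a` sits
  -- at `-s`.
  refine ((Equiv.subRight t).tsum_eq _).symm.trans (tsum_congr fun r => ?_)
  obtain ⟨s, rfl⟩ : ∃ s, t = r + s := ⟨t - r, by abel⟩
  have h1 : r - (r + s) = -s := by abel
  have h2 : -(r + s) - -s = -r := by abel
  have h3 : r + s - r = s := by abel
  simp only [Equiv.subRight_apply, coeff_star, map_mul, h1, h2, h3, twist_neg_neg,
    twist_add_left, twist_add_right]
  -- Bimultiplicativity expands `twist Ξ t t` into four factors. The mixed one, `twist Ξ s r`,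
  -- cancels the conjugated twist coming from the product `a * b`; the other three are those on the
  -- right.
  linear_combination (starRingEnd ℂ) (coeff a (-s)) * (starRingEnd ℂ) (coeff b (-r)) *
    (twist Ξ r r * twist Ξ r s * twist Ξ s s) * twist_mul_conj (Ξ := Ξ) s r

lemma star_smul_qtorus (c : ℂ) (a : QTorus Ξ) : star (c • a) = (starRingEnd ℂ) c • star a := by
  ext r
  simp [coeff_star, mul_assoc]

lemma star_zero_qtorus : star (0 : QTorus Ξ) = 0 := by
  ext r
  simp [coeff_star]

/-- Two signs cancel: one from conjugating `2πi`, one from replacing the frequency `r` by `-r`. -/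
lemma delta_star (j : Fin m) (a : QTorus Ξ) : delta j (star a) = star (delta j a) := by
  ext r
  simp only [coeff_delta, coeff_star, map_mul, Complex.conj_I, Pi.neg_apply, Complex.conj_ofReal,
    map_ofNat, map_intCast]
  push_cast
  ring

lemma delta_comm (j k : Fin m) (a : QTorus Ξ) : delta j (delta k a) = delta k (delta j a) := by
  ext r
  simp only [coeff_delta]
  ring

lemma delta_one (j : Fin m) : delta j (1 : QTorus Ξ) = 0 := by
  ext r
  rw [coeff_delta, coeff_one]
  by_cases h : r = 0
  · simp [h]
  · simp [Pi.single_eq_of_ne h]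

/-! ### The differential of functions -/

lemma d_of_apply (b : QTorus Ξ) (I : Finset (Fin m)) :
    d (of b) I = ∑ j, if I = {j} then Complex.I • delta j b else 0 := by
  rw [d_apply, ← Finset.sum_subset (Finset.subset_univ I)]
  · refine Finset.sum_congr rfl fun j hj => ?_
    by_cases hI : I = {j}
    · subst hI; simp [of_apply, sgn]
    · have h : I.erase j ≠ ∅ := fun h0 =>
        (Finset.erase_eq_empty_iff _ _ |>.mp h0).elim (fun h0 => by simp [h0] at hj) hI
      simp [of_apply, hI, h]
  · intro j _ hj
    refine if_neg ?_
    rintro rfl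
    simp at hj

lemma d_of_singleton (b : QTorus Ξ) (j : Fin m) : d (of b) {j} = Complex.I • delta j b := by
  simp [d_of_apply]

lemma d_of_eq_zero (b : QTorus Ξ) {I : Finset (Fin m)} (hI : I.card ≠ 1) : d (of b) I = 0 := by
  rw [d_of_apply]
  refine Finset.sum_eq_zero fun j _ => if_neg ?_
  rintro rfl
  simp at hI

/-- Reduces identities between one-forms to their coefficients at `dU_j`, where `d (of b)` is simply
`i δ_j b`. -/
lemma forms_one_ext {μ ν : Forms Ξ} (hμ : ∀ I : Finset (Fin m), I.card ≠ 1 → μ I = 0)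
    (hν : ∀ I : Finset (Fin m), I.card ≠ 1 → ν I = 0) (h : ∀ j, μ {j} = ν {j}) : μ = ν := by
  ext1 I
  by_cases hI : I.card = 1
  · obtain ⟨j, rfl⟩ := Finset.card_eq_one.mp hI
    exact h j
  · rw [hμ I hI, hν I hI]

lemma d_of_mem_degreePart (b : QTorus Ξ) : d (of b) ∈ degreePart Ξ 1 :=
  fun _ hI => d_of_eq_zero b hI

lemma d_of_one : d (of (1 : QTorus Ξ)) = 0 :=
  forms_one_ext (fun _ hI => d_of_eq_zero _ hI) (fun _ _ => rfl)
    fun j => by simp [d_of_singleton, delta_one]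

/-- Only coefficients at two-element sets `{j, k}` can survive. There the two terms cancel, because
`δ_j` and `δ_k` commute while the wedge sign is antisymmetric. -/
lemma d_d_of (b : QTorus Ξ) : d (d (of b)) = 0 := by
  ext1 K
  rw [d_apply, Pi.zero_apply]
  by_cases hK : K.card = 2
  · obtain ⟨j, k, hjk, rfl⟩ := Finset.card_eq_two.mp hK
    have h1 : ({j, k} : Finset (Fin m)).erase j = {k} := by
      ext i; simp; grind
    have h2 : ({j, k} : Finset (Fin m)).erase k = {j} := by
      ext i; simp; grind
    have h3 : sgn {k} {j} = -sgn {j} {k} := by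
      rcases lt_or_gt_of_ne hjk with h | h
      · simp [sgn, h, h.not_gt, Finset.filter_singleton]
      · simp [sgn, h, h.not_gt, Finset.filter_singleton]
    rw [Finset.sum_pair hjk, h1, h2, h3, d_of_singleton, d_of_singleton, map_smul, map_smul,
      delta_comm j k, neg_mul, neg_smul, add_neg_cancel]
  · refine Finset.sum_eq_zero fun j hj => ?_
    rw [d_of_eq_zero b, map_zero, smul_zero]
    rw [Finset.card_erase_of_mem hj]
    omega

lemma smul_of (a b : QTorus Ξ) : a • of b = of (a * b) := by
  ext1 I
  by_cases h : I = ∅ <;> simp [of_apply, h]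

lemma d_of_mul (a b : QTorus Ξ) :
    d (of (a * b)) = wedge (d (of a)) (of b) + a • d (of b) := by
  rw [← smul_of, d_smul]

lemma d_of_mul_singleton (a b : QTorus Ξ) (j : Fin m) :
    d (of (a * b)) {j} = Complex.I • (delta j a * b) + Complex.I • (a * delta j b) := by
  rw [d_of_singleton, delta_mul, smul_add]

lemma star_of (a : QTorus Ξ) : star (of a) = of (star a) := by
  ext1 I
  by_cases h : I = ∅ <;> simp [of_apply, h, star_zero_qtorus]

/-- The derivations commute with the involution, but the factor `i` in `d` is conjugated to `-i`.
The sign in the definition of the dual covariant derivative compensates for exactly this. -/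
lemma neg_star_d_of_star (a : QTorus Ξ) : -star (d (of (star a))) = d (of a) := by
  refine forms_one_ext (fun I hI => ?_) (fun I hI => d_of_eq_zero a hI) fun j => ?_
  · simp [d_of_eq_zero _ hI, star_zero_qtorus]
  · simp [d_of_singleton, star_smul_qtorus, delta_star, star_star_qtorus]

end Torus

/-! ### The germs map -/

/-- With `x = a - ε(a)` and `y = b - ε(b)` one has `ab - ε(ab) = ε(a) y + ε(b) x + x y`, and the
last term dies modulo the square of the augmentation ideal. So `π` is a derivation at the unit
element. -/
lemma germs_mul (a b : G) : germs (a * b)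
    = Coalgebra.counit (R := ℂ) a • germs b + Coalgebra.counit (R := ℂ) b • germs a := by
  set x := augProj a with hx
  set y := augProj b with hy
  have h : augProj (a * b) = Coalgebra.counit (R := ℂ) a • y + Coalgebra.counit (R := ℂ) b • x
      + x * y := by
    ext1
    simp [hx, hy, augProj, Algebra.smul_def]
    ring
  have h0 : augIdeal.toCotangent (x * y) = 0 := by
    rw [Ideal.toCotangent_eq_zero, pow_two]
    exact Ideal.mul_mem_mul x.2 y.2
  have h1 := congrArg (augIdeal.toCotangent.restrictScalars ℂ) h
  rw [map_add, map_add, map_smul, map_smul] at h1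
  simp only [LinearMap.coe_restrictScalars, h0, add_zero] at h1
  simp only [germs, LinearMap.smul_apply, LinearMap.comp_apply, LinearMap.coe_restrictScalars, h1,
    smul_add, ← hx, ← hy]
  rw [smul_comm, smul_comm Complex.I]

lemma germs_one : germs 1 = 0 := by
  have h := germs_mul 1 1
  simpa using h

lemma germs_T (k : ℤ) : germs (LaurentPolynomial.T k) = (k : ℂ) • theta := by
  have hadd : ∀ k l : ℤ, germs (LaurentPolynomial.T (k + l))
      = germs (LaurentPolynomial.T l) + germs (LaurentPolynomial.T k) := fun k l => by
    rw [LaurentPolynomial.T_add, germs_mul]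
    simp
  -- Since `ε(z^k) = 1`, the derivation rule makes `k ↦ π(z^k)` additive; a homomorphism from `ℤ` is
  -- determined by its value at `1`, here `ϑ`.
  let f : ℤ →+ U1Dual := AddMonoidHom.mk' (fun k => germs (LaurentPolynomial.T k))
    fun k l => (hadd k l).trans (add_comm _ _)
  have h : f k = k • f 1 := by
    rw [← map_zsmul, smul_eq_mul, mul_one]
  rw [Int.cast_smul_eq_zsmul]
  exact h

lemma germs_eq (g : G) : germs g = derivOne g • theta := by
  induction g using LaurentPolynomial.induction_on' with
  | add p q hp hq => rw [map_add, map_add, add_smul, hp, hq]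
  | C_mul_T k a =>
    have h : derivOne (LaurentPolynomial.T k) = k := by
      rw [LaurentPolynomial.T, derivOne_single, one_mul]
    rw [← LaurentPolynomial.smul_eq_C_mul, map_smul, map_smul, germs_T, h, smul_assoc]

/-- This and `kappa_theta` say that `u(1)^#` is one-dimensional, with basis `ϑ` and coordinate `κ`.
The factors `i` in `π` and `-i` in `κ` cancel. -/
lemma kappa_smul_theta (θ : U1Dual) : kappa θ • theta = θ := by
  obtain ⟨x, rfl⟩ := augIdeal.toCotangent_surjective θ
  have h := germs_eq x
  rw [germs_of_mem] at h
  have hk : kappa (augIdeal.toCotangent x) = -Complex.I * derivOne x := rfl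
  rw [hk, mul_smul, ← h, smul_smul]
  simp

lemma derivOne_T_one : derivOne (LaurentPolynomial.T 1) = 1 := by
  rw [LaurentPolynomial.T, derivOne_single]
  simp

/-- The constant `ε(g)` that `π` subtracts is invisible to the derivative at the unit. -/
lemma kappa_germs (g : G) : kappa (germs g) = derivOne g := by
  have h : derivOne (algebraMap ℂ G (Coalgebra.counit (R := ℂ) g)) = 0 := by
    rw [Algebra.algebraMap_eq_smul_one, map_smul, AddMonoidAlgebra.one_def, derivOne_single]
    simp
  have hk : kappa (germs g) = Complex.I * (-Complex.I * derivOne (augProj g : G)) := by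
    rw [germs, LinearMap.smul_apply, map_smul]
    rfl
  have hp : (augProj g : G) = g - algebraMap ℂ G (Coalgebra.counit (R := ℂ) g) := rfl
  rw [hk, hp, map_sub, h, sub_zero, ← mul_assoc]
  simp

lemma kappa_theta : kappa theta = 1 := by
  rw [theta, kappa_germs, derivOne_T_one]

section Bundle

variable {n : ℕ} {Ξ : Matrix (Fin (n + 1)) (Fin (n + 1)) ℝ}

/-! ### The base algebra and its forms -/

lemma coeff_incl (b : QTorus (baseMat Ξ)) (t : Fin (n + 1) → ℤ) :
    coeff (incl Ξ b) t = if t (Fin.last n) = 0 then coeff b (init t) else 0 := rfl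

lemma incl_injective : Function.Injective (incl Ξ) := fun a b h => by
  ext r
  have := congrArg (fun x => coeff x (snoc r 0)) h
  simpa [coeff_incl] using this

/-- The part of degree `0` with respect to the last generator. -/
noncomputable def baseProj (Ξ : Matrix (Fin (n + 1)) (Fin (n + 1)) ℝ) : QTorus Ξ →ₗ[ℂ] QTorus (baseMat Ξ) where
  toFun a := ofRapid (baseMat Ξ) (fun r => coeff a (snoc r 0)) ((coeff_rapid a).slice 0)
  map_add' _ _ := rfl
  map_smul' _ _ := rfl

lemma coeff_baseProj (a : QTorus Ξ) (r : Fin n → ℤ) :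
    coeff (baseProj Ξ a) r = coeff a (snoc r 0) := rfl

lemma coeff_eq_zero_of_coact {a : QTorus Ξ} (ha : coact Ξ a = tens Ξ a 1)
    {t : Fin (n + 1) → ℤ} (ht : t (Fin.last n) ≠ 0) : coeff a t = 0 := by
  -- At the index `(t, 0)` the right side has coefficient `a_t`, whereas the coaction puts `a_t` at
  -- `(t, t_{n+1})` and so contributes nothing here.
  have h := congrArg (fun x => coeff x (snoc t 0)) ha
  rw [tens_one] at h
  simpa [coeff_coact, coeff_push, ht.symm] using h.symm

/-- A coinvariant element has no monomials involving `u_{n+1}`, so projecting onto degree zero in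
that generator loses nothing: the coinvariants are exactly the image of the base algebra. -/
lemma incl_baseProj {a : QTorus Ξ} (ha : coact Ξ a = tens Ξ a 1) :
    incl Ξ (baseProj Ξ a) = a := by
  ext t
  rw [coeff_incl]
  split_ifs with ht
  · rw [coeff_baseProj, ← ht, snoc_init]
  · exact (coeff_eq_zero_of_coact ha ht).symm

lemma incl_star (b : QTorus (baseMat Ξ)) : incl Ξ (star b) = star (incl Ξ b) := by
  ext t
  rw [coeff_star, coeff_incl, coeff_incl, coeff_star]
  by_cases ht : t (Fin.last n) = 0
  · have h : twist Ξ t t = twist (baseMat Ξ) (init t) (init t) := by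
      rw [← twist_baseMat, ← ht, snoc_init]
    have h' : init (-t) = -init t := rfl
    simp [ht, h, h']
  · simp [ht]

lemma delta_incl_castSucc (j : Fin n) (b : QTorus (baseMat Ξ)) :
    delta j.castSucc (incl Ξ b) = incl Ξ (delta j b) := by
  ext t
  rw [coeff_delta, coeff_incl, coeff_incl, coeff_delta]
  split_ifs <;> simp [init]

lemma delta_last_incl (b : QTorus (baseMat Ξ)) : delta (Fin.last n) (incl Ξ b) = 0 := by
  ext t
  rw [coeff_delta, coeff_incl]
  split_ifs with h <;> simp [h]

lemma inclForm_apply (μ : Forms (baseMat Ξ)) (K : Finset (Fin (n + 1))) :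
    inclForm Ξ μ K = if Fin.last n ∈ K then 0 else incl Ξ (μ (lower K)) := rfl

lemma inclForm_injective : Function.Injective (inclForm Ξ) := fun μ ν h => by
  ext1 I
  have h1 := congrFun h (I.map Fin.castSuccEmb)
  have h2 : lower (I.map Fin.castSuccEmb) = I := by
    ext i; simp [lower]
  have h3 : Fin.last n ∉ I.map Fin.castSuccEmb := by
    simp [Fin.castSucc_ne_last]
  rw [inclForm_apply, inclForm_apply, if_neg h3, if_neg h3, h2] at h1
  exact incl_injective h1

/-- The last derivation kills the base algebra, so no component along `dU_{n+1}` appears; the others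
restrict to the derivations of the base. -/
lemma d_of_incl (b : QTorus (baseMat Ξ)) : d (of (incl Ξ b)) = inclForm Ξ (d (of b)) := by
  refine forms_one_ext (fun I hI => d_of_eq_zero _ hI) (fun I hI => ?_) fun j => ?_
  · rw [inclForm_apply]
    split_ifs with h
    · rfl
    · rw [d_of_eq_zero, map_zero]
      -- An index set avoiding the last index has the same cardinality as its counterpart on the
      -- base, so the degree is preserved.
      have h1 : I = (lower I).map Fin.castSuccEmb := by
        ext i
        refine Fin.lastCases ?_ (fun i => ?_) i
        · simp [h, Fin.castSucc_ne_last]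
        · simp [lower]
      rw [h1, Finset.card_map] at hI
      exact hI
  · rw [d_of_singleton, inclForm_apply]
    refine Fin.lastCases ?_ (fun j => ?_) j
    · simp [delta_last_incl]
    · have h : lower {j.castSucc} = {j} := by ext i; simp [lower]
      rw [if_neg (by simp [(Fin.castSucc_ne_last j).symm]), h, d_of_singleton, map_smul,
        delta_incl_castSucc]

/-! ### Covariant derivatives of functions on the base space -/

lemma sliceForm_coactForm_of_incl (b : QTorus (baseMat Ξ)) {k : ℤ} (hk : k ≠ 0) :
    sliceForm k (coactForm Ξ (of (incl Ξ b))) = 0 := by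
  ext I r
  have h3 : Fin.last (n + 1) ∉ I.map Fin.castSuccEmb := by
    simp [Fin.castSucc_ne_last]
  have h2 : lower (I.map Fin.castSuccEmb) = I := by
    ext i; simp [lower]
  show coeff (coactForm Ξ (of (incl Ξ b)) (I.map Fin.castSuccEmb)) (snoc r k) = 0
  have h : coactForm Ξ (of (incl Ξ b)) (I.map Fin.castSuccEmb) = coact Ξ (of (incl Ξ b) I) := by
    show (if _ then _ else _) = _
    rw [if_neg h3, h2]
  rw [h, of_apply]
  split_ifs
  · rw [coeff_coact, snoc_last, init_snoc, coeff_incl]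
    split_ifs with h4 h5
    · exact absurd (h4.trans h5) hk
    · rfl
    · rfl
  · simp

/-- The connection drops out. For `k ≠ 0` the coaction of `b` has no `z^k` component, and for `k =
0` the form `ω` is evaluated at `π(1) = 0`. -/
lemma covD_of_incl (ω : QPC Ξ) (b : QTorus (baseMat Ξ)) :
    covD ω (of (incl Ξ b)) = d (of (incl Ξ b)) := by
  have h : ∀ k : ℤ, wedge (gradeInv (sliceForm k (coactForm Ξ (of (incl Ξ b)))))
      (ω.toLin (germs (LaurentPolynomial.T k))) = 0 := fun k => by
    by_cases hk : k = 0
    · rw [hk, LaurentPolynomial.T_zero, germs_one, map_zero, map_zero]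
    · rw [sliceForm_coactForm_of_incl b hk, map_zero, map_zero, LinearMap.zero_apply]
  -- Every term is zero, so the value of the sum does not rest on the default for divergent series.
  rw [covD, tsum_congr h, tsum_zero, sub_zero]

lemma covDhat_of_incl (ω : QPC Ξ) (b : QTorus (baseMat Ξ)) :
    covDhat ω (of (incl Ξ b)) = inclForm Ξ (d (of b)) := by
  rw [covDhat, star_of, ← incl_star, covD_of_incl, incl_star, neg_star_d_of_star, d_of_incl]

/-! ### The trivialization of the associated bundle -/

/-- Because `ad θ = θ ⊗ 1`, the intertwining condition is just coinvariance of each value. -/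
lemma coact_E (T : E Ξ) (θ : U1Dual) : coact Ξ (E.toLin T θ) = tens Ξ (E.toLin T θ) 1 := by
  have h := E.toLin_mem T θ
  rw [ad_apply] at h
  simpa using h

/-- The coordinate `T(ϑ)` of an intertwiner with respect to `T^triv`. -/
noncomputable def baseCoord (Ξ : Matrix (Fin (n + 1)) (Fin (n + 1)) ℝ) : E Ξ →ₗ[ℂ] QTorus (baseMat Ξ) :=
  (baseProj Ξ).comp (E.toLin.flip theta)

lemma incl_baseCoord (T : E Ξ) : incl Ξ (baseCoord Ξ T) = E.toLin T theta :=
  incl_baseProj (coact_E T theta)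

lemma trivSection_apply (θ : U1Dual) : E.toLin (trivSection Ξ) θ = kappa θ • 1 := rfl

lemma toLin_apply (T : E Ξ) (θ : U1Dual) : E.toLin T θ = incl Ξ (kappa θ • baseCoord Ξ T) := by
  rw [map_smul, incl_baseCoord, ← map_smul, kappa_smul_theta]

/-- An intertwiner is determined by its value at the basis vector `ϑ`, and that value lies in the
base algebra. Hence `T^triv` generates the right module, freely since `incl` is injective. -/
lemma mulBase_trivSection (T : E Ξ) : E.mulBase (trivSection Ξ) (baseCoord Ξ T) = T :=
  E.ext fun θ => by
    rw [E.mulBase_apply, trivSection_apply, toLin_apply T, smul_mul_assoc, one_mul, map_smul]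

lemma baseCoord_mulBase (T : E Ξ) (b : QTorus (baseMat Ξ)) :
    baseCoord Ξ (E.mulBase T b) = baseCoord Ξ T * b :=
  incl_injective (by rw [incl_baseCoord, E.mulBase_apply, incl_mul, incl_baseCoord])

lemma incl_one : incl Ξ 1 = 1 := by
  ext t
  rw [coeff_incl, coeff_one, coeff_one]
  by_cases h : t = 0
  · have h0 : init (0 : Fin (n + 1) → ℤ) = 0 := rfl
    simp [h, h0]
  · rw [Pi.single_eq_of_ne h]
    split_ifs with h0
    · refine Pi.single_eq_of_ne (fun h1 => h ?_) _
      rw [← snoc_init t, h1, h0]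
      funext i
      refine Fin.lastCases ?_ (fun j => ?_) i <;> simp
    · rfl

lemma baseCoord_trivSection : baseCoord Ξ (trivSection Ξ) = 1 :=
  incl_injective (by rw [incl_baseCoord, trivSection_apply, kappa_theta, one_smul, incl_one])

namespace EForms

/-- Writing `T = T^triv b`, the balancing relation moves `b` onto the form: `T ⊗ μ = T^triv ⊗ b μ`.
Such tensors are closed under addition. -/
lemma exists_tmul_trivSection (x : EForms Ξ) : ∃ μ, x = tmul (trivSection Ξ) μ := by
  induction x using induct with
  | h T μ => exact ⟨baseCoord Ξ T • μ, by rw [← mulBase_tmul, mulBase_trivSection]⟩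
  | h0 => exact ⟨0, by rw [← tmulₗ_apply, map_zero]⟩
  | hadd x y hx hy =>
    obtain ⟨μ, rfl⟩ := hx
    obtain ⟨ν, rfl⟩ := hy
    exact ⟨μ + ν, by simp only [← tmulₗ_apply, map_add]⟩

lemma eval_tmul_trivSection (μ : Forms (baseMat Ξ)) (θ : U1Dual) :
    eval (tmul (trivSection Ξ) μ) θ = kappa θ • inclForm Ξ μ := by
  rw [eval_tmul, trivSection_apply]
  ext1 K
  simp

/-- Evaluating `T^triv ⊗ μ` at `ϑ` gives `μ` as a form on the total space, and the base forms embed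
there. This is what makes the gauge connection unique. -/
lemma eval_injective : Function.Injective (eval (Ξ := Ξ)) := fun x y h => by
  obtain ⟨μ, rfl⟩ := exists_tmul_trivSection x
  obtain ⟨ν, rfl⟩ := exists_tmul_trivSection y
  have h1 := LinearMap.congr_fun h theta
  rw [eval_tmul_trivSection, eval_tmul_trivSection, kappa_theta, one_smul, one_smul] at h1
  rw [inclForm_injective h1]

end EForms

/-! ### The Grassmann connection -/

/-- The Grassmann connection `∇ (T^triv b) = T^triv ⊗ db`. -/
noncomputable def grassmann (Ξ : Matrix (Fin (n + 1)) (Fin (n + 1)) ℝ) : QLC Ξ where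
  toLin := (EForms.tmulₗ (trivSection Ξ)).comp ((d.comp of).comp (baseCoord Ξ))
  degree_one T := Submodule.subset_span
    ⟨trivSection Ξ, d (of (baseCoord Ξ T)), d_of_mem_degreePart _, rfl⟩
  leibniz T b := by
    -- Once this term is moved onto `T^triv`, the Leibniz rule for the connection is that of `d`
    -- applied to the product of `T(ϑ)` and `b`.
    have h : EForms.tmul T (d (of b))
        = EForms.tmulₗ (trivSection Ξ) (baseCoord Ξ T • d (of b)) := by
      rw [EForms.tmulₗ_apply, ← EForms.mulBase_tmul, mulBase_trivSection]
    simp only [LinearMap.comp_apply, baseCoord_mulBase, d_of_mul, map_add, h]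
    simp only [EForms.tmulₗ_apply, EForms.mulForm_tmul]

lemma grassmann_apply (T : E Ξ) : (grassmann Ξ).toLin T
    = EForms.tmul (trivSection Ξ) (d (of (baseCoord Ξ T))) := rfl

/-- In the total space the Grassmann connection is `T ↦ d ∘ T`. Both the comparison with the gauge
connection and the metric compatibility are read off from this. -/
lemma eval_grassmann (T : E Ξ) (θ : U1Dual) :
    EForms.eval ((grassmann Ξ).toLin T) θ = d (of (E.toLin T θ)) := by
  rw [grassmann_apply, EForms.eval_tmul_trivSection, toLin_apply, d_of_incl]
  simp only [map_smul]

/-- The dual covariant derivative of `T(θ)` is the evaluation of the Grassmann connection,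
independently of `ω`. This gives existence; injectivity of the evaluation gives uniqueness. -/
lemma isGauge_iff (ω : QPC Ξ) (L : E Ξ →ₗ[ℂ] EForms Ξ) :
    IsGauge ω L ↔ L = (grassmann Ξ).toLin := by
  have h : ∀ T θ, covDhat ω (of (E.toLin T θ)) = EForms.eval ((grassmann Ξ).toLin T) θ :=
    fun T θ => by rw [eval_grassmann, toLin_apply, covDhat_of_incl, d_of_incl]
  constructor
  · exact fun hL => LinearMap.ext fun T => EForms.eval_injective <| LinearMap.ext fun θ =>
      (hL T θ).trans (h T θ)
  · rintro rfl T θ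
    exact (h T θ).symm

/-- With `s = S(ϑ)` and `t = T(ϑ)`, the left side is `s^* dt - (ds)^* t`. Since `(ds)^* = -d(s^*)`,
this is the Leibniz expansion of `d(s^* t)`. -/
lemma grassmann_isCompatible : (grassmann Ξ).IsCompatible := fun S T => by
  rw [metricRight, metricRight, eval_grassmann, eval_grassmann, metric]
  refine forms_one_ext (fun I hI => ?_) (fun I hI => d_of_eq_zero _ hI) fun j => ?_
  · simp [d_of_eq_zero _ hI, star_zero_qtorus]
  · rw [d_of_mul_singleton]
    simp only [Pi.sub_apply, Pi.star_apply, Pi.smul_apply, smul_eq_mul, d_of_singleton,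
      star_mul_qtorus, star_star_qtorus, star_smul_qtorus, delta_star, mul_smul_comm,
      Complex.conj_I, neg_smul]
    abel

lemma grassmann_isGrassmann : (grassmann Ξ).IsGrassmann := fun T =>
  ⟨baseCoord Ξ T, ⟨incl_baseCoord T, (mulBase_trivSection T).symm, rfl⟩,
    fun _ hb => incl_injective (hb.1.trans (incl_baseCoord T).symm)⟩

lemma grassmann_trivSection : (grassmann Ξ).toLin (trivSection Ξ) = 0 := by
  rw [grassmann_apply, baseCoord_trivSection, d_of_one, ← EForms.tmulₗ_apply, map_zero]

/-- Applying `d^∇` to `T^triv ⊗ db` gives `∇(T^triv) db + T^triv ⊗ d(db)`. The first term vanishes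
since `T^triv` is parallel, the second since `d² b = 0`. -/
lemma grassmann_curvature : (grassmann Ξ).curvature = 0 := by
  ext1 T
  rw [QLC.curvature, LinearMap.comp_apply, grassmann_apply, QLC.dExt, EForms.lift_tmul]
  simp only [LinearMap.add_apply, LinearMap.comp_apply,
    LinearMap.compl₂_apply, grassmann_trivSection, d_d_of, map_zero, add_zero,
    LinearMap.zero_apply]

lemma QLC.isYangMills_of_curvature_eq_zero {nabla : QLC Ξ} (h : nabla.curvature = 0) :
    nabla.IsYangMills := by
  -- With zero curvature its Hodge dual is the zero map, whose extension is zero, so both terms of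
  -- the commutator vanish whatever the sign attached to the degree.
  let L : RLin Ξ := ⟨0, fun T b => by simp⟩
  have hL : L.extend = 0 := EForms.hom_ext fun T μ => by
    simp [RLin.extend, L]
  refine ⟨L, by rw [h, LinearMap.comp_zero], ?_⟩
  rw [QLC.bracket, hL]
  simp [L]

end Bundle

end QuantumTorus

theorem theorem6 (n : ℕ) (hn : 2 ≤ n) (Ξ : Matrix (Fin (n + 1)) (Fin (n + 1)) ℝ)
    (hΞ : Ξ.transpose = -Ξ) (ω : QuantumTorus.QPC Ξ) :
    ∃ nabla : QuantumTorus.QLC Ξ,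
      (∀ L : QuantumTorus.E Ξ →ₗ[ℂ] QuantumTorus.EForms Ξ,
        QuantumTorus.IsGauge ω L ↔ L = nabla.toLin) ∧
      nabla.IsCompatible ∧ nabla.IsGrassmann ∧ nabla.curvature = 0 ∧ nabla.IsYangMills :=
  ⟨QuantumTorus.grassmann Ξ, QuantumTorus.isGauge_iff ω, QuantumTorus.grassmann_isCompatible,
    QuantumTorus.grassmann_isGrassmann, QuantumTorus.grassmann_curvature,
    QuantumTorus.QLC.isYangMills_of_curvature_eq_zero QuantumTorus.grassmann_curvature⟩
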